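/- **Theorem 3.1.** Let $A$ be an Artin algebra, that is, an algebra which is finitely generated as a module over a commutative Artinian ring $R$. A left $A$-module $X$ is *Gorenstein projective* if there is an exact sequence $\cdots \to P_1 \to P_0 \to P^0 \to P^1 \to \cdots$ of finitely generated projective left $A$-modules that remains exact under $\mathrm{Hom}_A(-,Q)$ for every finitely generated projective $A$-module $Q$, and such that $X \cong \mathrm{Im}(P_0 \to P^0)$. Assume that $A$ is *CM-finite*, i.e. there are only finitely many isomorphism classes of indecomposable Gorenstein projective $A$-modules, and let $E$ be an $A$-module such that the Gorenstein projective $A$-modules are exactly the modules in $\mathrm{add}\,E$, i.e. the direct summands of finite direct sums of copies of $E$. For a ring $S$ let $\mathrm{fin.dim}\,S$ be the supremum of the projective dimensions of the finitely generated left $S$-modules of finite projective dimension, and assume that $\mathrm{fin.dim}\,A \ge 2$. Let $M$ be a Gorenstein projective $A$-module and let $B = \mathrm{End}_A M$, with multiplication such that $M$ is an $A$-$B$-bimodule; then $\mathrm{Hom}_A(M,E)$ is a left $B$-module by $(bf)(m) = f(mb)$. Let $\mathrm{rfd}(M_B)$ denote the little restricted flat dimension of the right $B$-module $M$: the least integer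 $m \ge 0$ such that $\mathrm{Tor}^B_i(M,Y) = 0$ for all $i > m$ and all left $B$-modules $Y$ of finite flat dimension which admit a projective resolution by finitely generated projective modules (and $\infty$ if there is no such $m$). Then $$\mathrm{fin.dim}\,B \;\le\; \mathrm{fin.dim}\,A + \mathrm{rfd}(M_B) + \mathrm{pd}_B\,\mathrm{Hom}_A(M,E),$$ where the dimensions may be infinite. (Convention: $\mathrm{pd}\,0 = -\infty$, and a sum with a term $-\infty$ is $-\infty$; this matters only for $M = 0$, where both sides are $-\infty$.) -/

import Mathlib

open CategoryTheory TensorProduct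

universe u

noncomputable section

/-! ### Tensor products and `Tor` over a possibly noncommutative ring -/

section Tensor

variable (B : Type u) [Ring B]

/-- The subgroup of `T ⊗_ℤ Y` generated by the elements `(t b) ⊗ y - t ⊗ (b y)`, for a right
`B`-module `T` (that is, a module over `Bᵐᵒᵖ`) and a left `B`-module `Y`. -/
def balancedRelations (T Y : Type u) [AddCommGroup T] [Module Bᵐᵒᵖ T]
    [AddCommGroup Y] [Module B Y] : AddSubgroup (T ⊗[ℤ] Y) :=
  AddSubgroup.closure {z | ∃ (t : T) (b : B) (y : Y),
    z = (MulOpposite.op b • t) ⊗ₜ[ℤ] y - t ⊗ₜ[ℤ] (b • y)}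

/-- The tensor product `T ⊗_B Y` of a right `B`-module `T` and a left `B`-module `Y`, an abelian
group. -/
abbrev BalancedTensor (T Y : Type u) [AddCommGroup T] [Module Bᵐᵒᵖ T]
    [AddCommGroup Y] [Module B Y] : Type u :=
  (T ⊗[ℤ] Y) ⧸ balancedRelations B T Y

variable {T T' Y Y' : Type u} [AddCommGroup T] [Module Bᵐᵒᵖ T] [AddCommGroup T'] [Module Bᵐᵒᵖ T']
  [AddCommGroup Y] [Module B Y] [AddCommGroup Y'] [Module B Y']

/-- The element `t ⊗ y` of `T ⊗_B Y`. -/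
def BalancedTensor.tmul (t : T) (y : Y) : BalancedTensor B T Y :=
  QuotientAddGroup.mk' (balancedRelations B T Y) (t ⊗ₜ[ℤ] y)

/-- The map `f ⊗ g : T ⊗_B Y → T' ⊗_B Y'`. -/
def BalancedTensor.map (f : T →ₗ[Bᵐᵒᵖ] T') (g : Y →ₗ[B] Y') :
    BalancedTensor B T Y →+ BalancedTensor B T' Y' :=
  QuotientAddGroup.map _ _
    (TensorProduct.map f.toAddMonoidHom.toIntLinearMap
      g.toAddMonoidHom.toIntLinearMap).toAddMonoidHom (by
      rw [balancedRelations, AddSubgroup.closure_le]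
      rintro _ ⟨t, b, y, rfl⟩
      refine AddSubgroup.subset_closure ⟨f t, b, g y, ?_⟩
      rw [map_sub]
      change f (MulOpposite.op b • t) ⊗ₜ[ℤ] g y - f t ⊗ₜ[ℤ] g (b • y) = _
      rw [map_smul, map_smul])

theorem BalancedTensor.map_tmul (f : T →ₗ[Bᵐᵒᵖ] T') (g : Y →ₗ[B] Y') (t : T) (y : Y) :
    BalancedTensor.map B f g (BalancedTensor.tmul B t y) =
      BalancedTensor.tmul B (f t) (g y) := rfl

theorem BalancedTensor.tmul_add (t : T) (y y' : Y) :
    BalancedTensor.tmul B t (y + y') = BalancedTensor.tmul B t y + BalancedTensor.tmul B t y' := by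
  rw [BalancedTensor.tmul, TensorProduct.tmul_add, map_add]
  rfl

theorem BalancedTensor.hom_ext {Z : Type*} [AddCommGroup Z] {p q : BalancedTensor B T Y →+ Z}
    (h : ∀ (t : T) (y : Y), p (BalancedTensor.tmul B t y) = q (BalancedTensor.tmul B t y)) :
    p = q := by
  refine QuotientAddGroup.addMonoidHom_ext _ (AddMonoidHom.ext fun z => ?_)
  induction z using TensorProduct.induction_on with
  | zero => rw [map_zero, map_zero]
  | tmul t y => exact h t y
  | add a b ha hb => rw [map_add, map_add, ha, hb]

variable (T) in
/-- The functor `T ⊗_B -` from left `B`-modules to abelian groups, for a right `B`-module `T`. -/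
def tensorFunctor : ModuleCat.{u} B ⥤ AddCommGrpCat.{u} where
  obj Y := AddCommGrpCat.of (BalancedTensor B T Y)
  map g := AddCommGrpCat.ofHom (BalancedTensor.map B (LinearMap.id : T →ₗ[Bᵐᵒᵖ] T) g.hom)
  map_id Y := by
    ext : 1
    exact BalancedTensor.hom_ext B fun t y => rfl
  map_comp g h := by
    ext : 1
    exact BalancedTensor.hom_ext B fun t y => rfl

instance tensorFunctor_additive : (tensorFunctor B T).Additive where
  map_add {Y Y' g h} := by
    ext : 1
    exact BalancedTensor.hom_ext B fun t y => BalancedTensor.tmul_add B t (g.hom y) (h.hom y)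

variable (T) in
/-- `Tor_i^B(T, Y)`, the `i`-th left derived functor of `T ⊗_B -` at the left `B`-module `Y`. -/
def torGroup (i : ℕ) (Y : ModuleCat.{u} B) : AddCommGrpCat.{u} :=
  ((tensorFunctor B T).leftDerived i).obj Y

/-- A left `B`-module `F` is flat if `- ⊗_B F` preserves injectivity of maps of right
`B`-modules. -/
def IsFlatLeft (F : ModuleCat.{u} B) : Prop :=
  ∀ (X X' : ModuleCat.{u} Bᵐᵒᵖ) (f : X →ₗ[Bᵐᵒᵖ] X'), Function.Injective f →
    Function.Injective (BalancedTensor.map B f (LinearMap.id : F →ₗ[B] F))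

/-- `Y` has flat dimension at most `n`: there is an exact sequence
`0 → F_n → ⋯ → F_0 → Y → 0` of left `B`-modules with all `F_i` flat. -/
def FlatDimLE : ℕ → ModuleCat.{u} B → Prop
  | 0, Y => IsFlatLeft B Y
  | n + 1, Y => ∃ (K F : ModuleCat.{u} B) (f : K →ₗ[B] F) (g : F →ₗ[B] Y),
      Function.Injective f ∧ Function.Exact f g ∧ Function.Surjective g ∧
        IsFlatLeft B F ∧ FlatDimLE n K

/-- `Y` admits a projective resolution consisting of finitely generated projectives. -/
def HasFGProjectiveResolution (Y : ModuleCat.{u} B) : Prop :=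
  ∃ P : ProjectiveResolution Y, ∀ i : ℕ, Module.Finite B (P.complex.X i)

variable (T) in
/-- The right `B`-module `T` has little restricted flat dimension at most `m`. -/
def LittleRestrictedFlatDimLE (m : ℕ) : Prop :=
  ∀ i : ℕ, m < i → ∀ Y : ModuleCat.{u} B, (∃ n : ℕ, FlatDimLE B n Y) →
    HasFGProjectiveResolution B Y → Limits.IsZero (torGroup B T i Y)

variable (T) in
/-- The little restricted flat dimension `rfd(T_B)`; it is `⊤` if no bound exists. -/
def littleRestrictedFlatDim : ℕ∞ :=
  ⨅ (m : ℕ) (_ : LittleRestrictedFlatDimLE B T m), (m : ℕ∞)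

end Tensor

/-! ### Finitistic dimension -/

/-- `fin.dim B`: the supremum of the projective dimensions of the finitely generated left
`B`-modules of finite projective dimension. -/
def finDim (B : Type u) [Ring B] : WithBot ℕ∞ :=
  ⨆ (Y : ModuleCat.{u} B) (_ : Module.Finite B Y) (_ : projectiveDimension Y < ⊤),
    projectiveDimension Y

/-! ### Gorenstein projective modules -/

section Gorenstein

variable (A : Type u) [Ring A]

/-- `X` is Gorenstein projective: it is isomorphic to an image in an exact sequence
`⋯ → P (-1) → P 0 → P 1 → ⋯` of finitely generated projective `A`-modules that stays exact under
`Hom_A(-, Q)` for all finitely generated projective `Q`. -/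
def IsGorensteinProjective (X : ModuleCat.{u} A) : Prop :=
  ∃ (P : ℤ → ModuleCat.{u} A) (d : ∀ i : ℤ, P i →ₗ[A] P (i + 1)),
    (∀ i, Module.Finite A (P i) ∧ Module.Projective A (P i)) ∧
    (∀ i, Function.Exact (d i) (d (i + 1))) ∧
    (∀ Q : ModuleCat.{u} A, Module.Finite A Q → Module.Projective A Q → ∀ i : ℤ,
      Function.Exact (fun h : P (i + 1 + 1) →ₗ[A] Q => h.comp (d (i + 1)))
        (fun h : P (i + 1) →ₗ[A] Q => h.comp (d i))) ∧
    Nonempty (X ≃ₗ[A] LinearMap.range (d 0))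

/-- `X` lies in `add E`: it is a direct summand of a finite direct sum of copies of `E`. -/
def IsInAdd (E X : ModuleCat.{u} A) : Prop :=
  ∃ (n : ℕ) (s : X →ₗ[A] (Fin n → E)) (r : (Fin n → E) →ₗ[A] X), r.comp s = LinearMap.id

/-- `A` is CM-finite: there are only finitely many isomorphism classes of indecomposable
(finitely generated) Gorenstein projective `A`-modules. -/
def IsCMFinite : Prop :=
  ∃ S : Set (ModuleCat.{u} A), S.Finite ∧
    ∀ X : ModuleCat.{u} A, IsGorensteinProjective A X → Indecomposable X →
      ∃ Y ∈ S, Nonempty (X ≅ Y)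

/-- The endomorphism algebra `B = End_A M` of a left `A`-module `M`, with the multiplication for
which `M` is an `A`-`B`-bimodule: `m (b b') = (m b) b'`. As a ring it is opposite to
`Module.End A M`, where multiplication is composition of functions. Mathlib's `DomMulAct` makes
`Hom_A(M, E)` a left module over it by `(b f)(m) = f (m b)`. -/
abbrev EndAlg (M : Type u) [AddCommGroup M] [Module A M] : Type u :=
  (Module.End A M)ᵈᵐᵃ

/-- `M` as a right module over `B = End_A M`. -/
instance EndAlg.rightModule (M : Type u) [AddCommGroup M] [Module A M] :
    Module (EndAlg A M)ᵐᵒᵖ M where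
  smul b m := DomMulAct.mk.symm b.unop m
  one_smul _ := rfl
  mul_smul _ _ _ := rfl
  smul_zero b := map_zero (DomMulAct.mk.symm b.unop)
  smul_add b := map_add (DomMulAct.mk.symm b.unop)
  add_smul _ _ _ := rfl
  zero_smul _ := rfl

end Gorenstein

end

/-!
Let `Y` be a finitely generated `B`-module of finite projective dimension, where `B = End_A M`, and
let `n = fin.dim A`, `m = rfd(M_B)` and `p = pd_B Hom_A(M, E)` be finite. Take a finite resolution
`P` of `Y` by finitely generated projectives. In degrees above `m` the complex `M ⊗_B P` is exact,
because its homology there is `Tor^B(M, Y)`, and its terms lie in `add M`, so they are Gorenstein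
projective (`SyzygySequence.exact_tensor`, `BalancedTensor.isInAdd`).

Hence the cokernel `X` of `M ⊗ P_{m+1} → M ⊗ P_m` has a finite resolution by Gorenstein
projectives. Such an `X` embeds into a finitely generated module of finite projective dimension
with Gorenstein projective cokernel (`HasGorensteinResolution.exists_hull`), so
`Ext^i_A(X, Q) = 0` for `i > n` and `Q` finitely generated projective. Therefore the `n`-th syzygy
`Z` of `X` has no higher extensions by projectives, which for a module of finite Gorenstein
projective dimension forces it to be Gorenstein projective (`isGorensteinProjective_range`); that
is, `Z` lies in `add E`.

As `n ≥ 2`, the module `Z` is the kernel of `M ⊗ P_{m+n-1} → M ⊗ P_{m+n-2}`. The functor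
`Hom_A(M, -)` is left exact, and the unit `Q → Hom_A(M, M ⊗_B Q)` is an isomorphism for finitely
generated projective `Q` (`BalancedTensor.unit_bijective`). So `Hom_A(M, Z)` is the `(m+n)`-th
syzygy of `Y` (`BalancedTensor.linearEquivHom`). It is a direct summand of a power of
`Hom_A(M, E)`, so its projective dimension is at most `p`, and `pd Y ≤ n + m + p`.

The tensor-hom part is carried out for an `A`-`B`-bimodule `M` over an arbitrary ring `B` that acts
as the full endomorphism ring, and is applied to `B = EndAlg A M` at the end.
-/

noncomputable section

/-! ### Short exact sequences and `Ext` into projective modules -/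

section ShortExact

variable {A : Type u} [Ring A]

/-- `0 → X → Y → Z → 0` is a short exact sequence of modules, given by linear maps. -/
structure IsShortExact {X Y Z : Type u} [AddCommGroup X] [Module A X] [AddCommGroup Y] [Module A Y]
    [AddCommGroup Z] [Module A Z] (f : X →ₗ[A] Y) (g : Y →ₗ[A] Z) : Prop where
  injective : Function.Injective f
  exact : Function.Exact f g
  surjective : Function.Surjective g

variable {X Y Z : ModuleCat.{u} A} {f : X →ₗ[A] Y} {g : Y →ₗ[A] Z}

theorem IsShortExact.exists_shortExact (h : IsShortExact f g) :
    ∃ w : (ModuleCat.ofHom f : X ⟶ Y) ≫ (ModuleCat.ofHom g : Y ⟶ Z) = 0,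
      (ShortComplex.mk (ModuleCat.ofHom f : X ⟶ Y) (ModuleCat.ofHom g : Y ⟶ Z) w).ShortExact :=
  ⟨ModuleCat.hom_ext h.exact.linearMap_comp_eq_zero,
    ModuleCat.shortComplex_shortExact _ h.exact h.injective h.surjective⟩

theorem isShortExact_subtype_ker (hg : Function.Surjective g) :
    IsShortExact (LinearMap.ker g).subtype g :=
  ⟨Subtype.val_injective, LinearMap.exact_subtype_ker_map g, hg⟩

theorem isShortExact_mkQ_range (hf : Function.Injective f) :
    IsShortExact f (LinearMap.range f).mkQ :=
  ⟨hf, LinearMap.exact_map_mkQ_range f, Submodule.mkQ_surjective _⟩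

/-- `Ext^i_A(X, Q) = 0` for all finitely generated projective `A`-modules `Q`. -/
def ExtProjVanishes (X : ModuleCat.{u} A) (i : ℕ) : Prop :=
  ∀ Q : ModuleCat.{u} A, Module.Finite A Q → Module.Projective A Q →
    Subsingleton (Abelian.Ext.{u} X Q i)

theorem ExtProjVanishes.middle (h : IsShortExact f g) {i : ℕ} (hX : ExtProjVanishes X i)
    (hZ : ExtProjVanishes Z i) : ExtProjVanishes Y i := by
  intro Q h1 h2
  obtain ⟨w, hS⟩ := h.exists_shortExact
  have := hX Q h1 h2
  have := hZ Q h1 h2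
  refine subsingleton_of_forall_eq 0 fun x => ?_
  obtain ⟨x₃, rfl⟩ := Abelian.Ext.contravariant_sequence_exact₂ hS _ x (Subsingleton.elim _ _)
  rw [Subsingleton.elim x₃ 0, Abelian.Ext.comp_zero]

theorem ExtProjVanishes.right (h : IsShortExact f g) {i : ℕ} (hX : ExtProjVanishes X i)
    (hY : ExtProjVanishes Y (i + 1)) : ExtProjVanishes Z (i + 1) := by
  intro Q h1 h2
  obtain ⟨w, hS⟩ := h.exists_shortExact
  have := hX Q h1 h2
  have := hY Q h1 h2
  refine subsingleton_of_forall_eq 0 fun x => ?_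
  obtain ⟨x₁, rfl⟩ := Abelian.Ext.contravariant_sequence_exact₃ hS _ x
    (Subsingleton.elim _ _) (add_comm _ _)
  rw [Subsingleton.elim x₁ 0, Abelian.Ext.comp_zero]

theorem ExtProjVanishes.left (h : IsShortExact f g) {i : ℕ} (hY : ExtProjVanishes Y i)
    (hZ : ExtProjVanishes Z (i + 1)) : ExtProjVanishes X i := by
  intro Q h1 h2
  obtain ⟨w, hS⟩ := h.exists_shortExact
  have := hY Q h1 h2
  have := hZ Q h1 h2
  refine subsingleton_of_forall_eq 0 fun x => ?_
  obtain ⟨x₁, rfl⟩ := Abelian.Ext.contravariant_sequence_exact₁ hS _ x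
    (add_comm _ _) (Subsingleton.elim _ _)
  rw [Subsingleton.elim x₁ 0, Abelian.Ext.comp_zero]

theorem ExtProjVanishes.of_projective (hX : Module.Projective A X) (i : ℕ) :
    ExtProjVanishes X (i + 1) := by
  intro Q _ _
  have : Projective X := (IsProjective.iff_projective X).1 hX
  exact HasProjectiveDimensionLT.subsingleton X 1 (i + 1) (by lia) Q

theorem ExtProjVanishes.of_retract {s : X →ₗ[A] Y} {r : Y →ₗ[A] X} (h : r.comp s = LinearMap.id)
    {i : ℕ} (hY : ExtProjVanishes Y i) : ExtProjVanishes X i := by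
  intro Q h1 h2
  have := hY Q h1 h2
  refine subsingleton_of_forall_eq 0 fun x => ?_
  have hsr : (ModuleCat.ofHom s : X ⟶ Y) ≫ (ModuleCat.ofHom r : Y ⟶ X) = 𝟙 X :=
    ModuleCat.hom_ext h
  rw [← x.mk₀_id_comp, ← hsr, ← Abelian.Ext.mk₀_comp_mk₀,
    Abelian.Ext.comp_assoc_of_second_deg_zero,
    Subsingleton.elim ((Abelian.Ext.mk₀ (ModuleCat.ofHom r : Y ⟶ X)).comp x (zero_add i)) 0,
    Abelian.Ext.comp_zero]

theorem ExtProjVanishes.of_linearEquiv (e : X ≃ₗ[A] Y) {i : ℕ} (hY : ExtProjVanishes Y i) :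
    ExtProjVanishes X i :=
  .of_retract (s := e.toLinearMap) (r := e.symm.toLinearMap) (by ext; simp) hY

/-- If `Ext^1(Z, Q) = 0`, then maps into `Q` extend along a monomorphism with cokernel `Z`. -/
theorem ExtProjVanishes.exists_extension (h : IsShortExact f g) (hZ : ExtProjVanishes Z 1)
    {Q : ModuleCat.{u} A} (h1 : Module.Finite A Q) (h2 : Module.Projective A Q)
    (p : X →ₗ[A] Q) : ∃ q : Y →ₗ[A] Q, q.comp f = p := by
  obtain ⟨w, hS⟩ := h.exists_shortExact
  have := hZ Q h1 h2
  obtain ⟨x, hx⟩ := Abelian.Ext.contravariant_sequence_exact₁ hS _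
    (Abelian.Ext.mk₀ (ModuleCat.ofHom p : X ⟶ Q)) (add_comm _ _) (Subsingleton.elim _ _)
  obtain ⟨q, rfl⟩ := Abelian.Ext.homEquiv₀.symm.surjective x
  refine ⟨q.hom, ?_⟩
  rw [Abelian.Ext.homEquiv₀_symm_apply, Abelian.Ext.mk₀_comp_mk₀] at hx
  have := Abelian.Ext.homEquiv₀.symm.injective hx
  exact congrArg ModuleCat.Hom.hom this

/-- If `Y` is projective and all maps from `X` to finitely generated projectives extend to `Y`,
then `Ext^1(Z, -)` vanishes on finitely generated projectives. -/
theorem ExtProjVanishes.one_of_exists_extension (h : IsShortExact f g)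
    (hY : Module.Projective A Y)
    (H : ∀ Q : ModuleCat.{u} A, Module.Finite A Q → Module.Projective A Q →
      ∀ p : X →ₗ[A] Q, ∃ q : Y →ₗ[A] Q, q.comp f = p) : ExtProjVanishes Z 1 := by
  intro Q h1 h2
  obtain ⟨w, hS⟩ := h.exists_shortExact
  have := ExtProjVanishes.of_projective hY 0 Q h1 h2
  refine subsingleton_of_forall_eq 0 fun x => ?_
  obtain ⟨x₁, rfl⟩ := Abelian.Ext.contravariant_sequence_exact₃ hS _ x
    (Subsingleton.elim _ _) (add_comm _ _)
  obtain ⟨p, rfl⟩ := Abelian.Ext.homEquiv₀.symm.surjective x₁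
  obtain ⟨q, hq⟩ := H Q h1 h2 p.hom
  have : p = ModuleCat.ofHom f ≫ ModuleCat.ofHom q := ModuleCat.hom_ext hq.symm
  rw [Abelian.Ext.homEquiv₀_symm_apply, this, ← Abelian.Ext.mk₀_comp_mk₀]
  exact hS.extClass_comp_assoc _

/-- The pushout of two monomorphisms, with the two short exact sequences through it. -/
theorem exists_pushout {X' Z' : ModuleCat.{u} A} {f' : X →ₗ[A] X'} {g' : X' →ₗ[A] Z'}
    (h : IsShortExact f g) (h' : IsShortExact f' g') :
    ∃ (V : ModuleCat.{u} A) (a : X' →ₗ[A] V) (b : V →ₗ[A] Z) (c : Y →ₗ[A] V) (e : V →ₗ[A] Z'),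
      IsShortExact a b ∧ IsShortExact c e := by
  let N : Submodule A (Y × X') := LinearMap.range (f.prod (-f'))
  have hf (x) : g (f x) = 0 := h.exact.apply_apply_eq_zero x
  have hf' (x) : g' (f' x) = 0 := h'.exact.apply_apply_eq_zero x
  refine ⟨ModuleCat.of A ((Y × X') ⧸ N), N.mkQ.comp (LinearMap.inr A Y X'),
    N.liftQ (g.comp (LinearMap.fst A Y X')) ?_, N.mkQ.comp (LinearMap.inl A Y X'),
    N.liftQ (g'.comp (LinearMap.snd A Y X')) ?_, ⟨?_, ?_, ?_⟩, ⟨?_, ?_, ?_⟩⟩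
  · rintro _ ⟨x, rfl⟩
    simp [hf]
  · rintro _ ⟨x, rfl⟩
    simp [hf']
  · rw [← LinearMap.ker_eq_bot, LinearMap.ker_eq_bot']
    intro x hx
    obtain ⟨y, hy⟩ := (Submodule.Quotient.mk_eq_zero N).1 hx
    have h1 : f y = 0 := congrArg Prod.fst hy
    have h2 : -f' y = x := congrArg Prod.snd hy
    rw [← h2, h.injective (h1.trans (map_zero f).symm)]
    simp
  · intro z
    obtain ⟨⟨y, x⟩, rfl⟩ := Submodule.mkQ_surjective N z
    constructor
    · intro hz
      obtain ⟨t, rfl⟩ := (h.exact y).1 hz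
      refine ⟨x + f' t, (Submodule.Quotient.eq N).2 ⟨-t, ?_⟩⟩
      simp
    · rintro ⟨t, ht⟩
      rw [← ht]
      simp
  · intro z
    obtain ⟨y, rfl⟩ := h.surjective z
    exact ⟨N.mkQ (y, 0), rfl⟩
  · rw [← LinearMap.ker_eq_bot, LinearMap.ker_eq_bot']
    intro x hx
    obtain ⟨y, hy⟩ := (Submodule.Quotient.mk_eq_zero N).1 hx
    have h1 : f y = x := congrArg Prod.fst hy
    have h2 : -f' y = 0 := congrArg Prod.snd hy
    rw [neg_eq_zero] at h2
    rw [← h1, h'.injective (h2.trans (map_zero f').symm)]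
    simp
  · intro z
    obtain ⟨⟨y, x⟩, rfl⟩ := Submodule.mkQ_surjective N z
    constructor
    · intro hz
      obtain ⟨t, rfl⟩ := (h'.exact x).1 hz
      refine ⟨y + f t, (Submodule.Quotient.eq N).2 ⟨t, ?_⟩⟩
      simp
    · rintro ⟨t, ht⟩
      rw [← ht]
      simp
  · intro z
    obtain ⟨y, rfl⟩ := h'.surjective z
    exact ⟨N.mkQ (0, y), rfl⟩

theorem IsShortExact.finite_middle (h : IsShortExact f g) (hX : Module.Finite A X)
    (hZ : Module.Finite A Z) : Module.Finite A Y :=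
  Module.Finite.of_exact h.exact h.surjective

/-- A short exact sequence splits if the identity of its first term extends to its second. -/
theorem IsShortExact.exists_section (h : IsShortExact f g) {q : Y →ₗ[A] X}
    (hq : q.comp f = LinearMap.id) : ∃ s : Z →ₗ[A] Y, g.comp s = LinearMap.id := by
  have hsplit := (h.exact.split_tfae h.injective h.surjective).out 1 0
  exact hsplit.1 ⟨q, hq⟩

/-- Maps that vanish on the first term of a short exact sequence descend to the last one. -/
theorem IsShortExact.exists_desc (h : IsShortExact f g) {W : ModuleCat.{u} A} (p : Y →ₗ[A] W)
    (hp : p.comp f = 0) : ∃ q : Z →ₗ[A] W, ∀ y, q (g y) = p y := by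
  let e := h.exact.linearEquivOfSurjective h.surjective
  refine ⟨((LinearMap.range f).liftQ p (LinearMap.range_le_ker_iff.2 hp)).comp
    e.symm.toLinearMap, fun y => ?_⟩
  have : e.symm (g y) = (LinearMap.range f).mkQ y := e.symm_apply_eq.2 rfl
  rw [LinearMap.comp_apply, LinearEquiv.coe_coe, this]
  rfl

/-- A relation with a left-total part and a part closed under successors has bi-infinite chains. -/
theorem exists_int_chain {D : Type*} (r : D → D → Prop) (C : D → Prop)
    (hprev : ∀ x, ∃ y, r y x) (hnext : ∀ x, C x → ∃ y, r x y ∧ C y) (x : D) (hx : C x) (k : ℤ) :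
    ∃ φ : ℤ → D, φ k = x ∧ ∀ i, r (φ i) (φ (i + 1)) := by
  choose p hp using hprev
  choose n hn hnC using hnext
  let u : ℕ → {y // C y} := fun j => (fun y : {y // C y} => ⟨n y.1 y.2, hnC y.1 y.2⟩)^[j] ⟨x, hx⟩
  let φ : ℤ → D := fun i => match i with
    | Int.ofNat j => (u j).1
    | Int.negSucc j => p^[j + 1] x
  have hφ : ∀ i, r (φ i) (φ (i + 1)) := by
    rintro (j | j)
    · change r (u j).1 (u (j + 1)).1
      simp only [u, Function.iterate_succ_apply']
      exact hn _ _
    · rcases j with _ | j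
      · exact hp x
      · change r (p^[j + 1 + 1] x) (φ (Int.negSucc j))
        rw [Function.iterate_succ_apply' p (j + 1)]
        exact hp _
  refine ⟨fun i => φ (i - k), by simp [φ, u], fun i => ?_⟩
  have := hφ (i - k)
  rwa [show i - k + 1 = i + 1 - k by ring] at this

end ShortExact

/-! ### Gorenstein projective modules -/

section GorensteinProjective

variable {A : Type u} [Ring A]

/-- An exact pair `X → Y → Z` restricts to the short exact sequence of the two images. -/
theorem isShortExact_range {X Y Z : ModuleCat.{u} A} {f : X →ₗ[A] Y} {g : Y →ₗ[A] Z}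
    (h : Function.Exact f g) :
    IsShortExact (LinearMap.range f).subtype g.rangeRestrict := by
  refine ⟨Subtype.val_injective, fun y => ?_, g.surjective_rangeRestrict⟩
  rw [← Submodule.coe_eq_zero]
  exact (h y).trans ⟨fun ⟨x, hx⟩ => ⟨⟨y, x, hx⟩, rfl⟩, fun ⟨⟨_, x, hx⟩, hy⟩ => ⟨x, hx.trans hy⟩⟩

theorem IsGorensteinProjective.finite {X : ModuleCat.{u} A} (hX : IsGorensteinProjective A X) :
    Module.Finite A X := by
  obtain ⟨P, d, hP, -, -, ⟨e⟩⟩ := hX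
  have := (hP 0).1
  exact Module.Finite.equiv e.symm

theorem IsGorensteinProjective.extProjVanishes {X : ModuleCat.{u} A}
    (hX : IsGorensteinProjective A X) (k : ℕ) : ExtProjVanishes X (k + 1) := by
  obtain ⟨P, d, hP, hd, hQ, ⟨e⟩⟩ := hX
  have hses (i : ℤ) := isShortExact_range (hd i)
  -- All images in the complex are treated at once, as `Ext^(k+1)` shifts to `Ext^k` of the
  -- previous one.
  suffices H : ∀ (k : ℕ) (i : ℤ),
      ExtProjVanishes (ModuleCat.of A (LinearMap.range (d i))) (k + 1) from
    (H k 0).of_linearEquiv (Y := ModuleCat.of A (LinearMap.range (d 0))) e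
  intro k
  induction k with
  | zero =>
    intro i
    obtain ⟨j, rfl⟩ : ∃ j, i = j + 1 + 1 := ⟨i - 2, by ring⟩
    refine .one_of_exists_extension (X := ModuleCat.of A (LinearMap.range (d (j + 1))))
      (Y := P (j + 1 + 1)) (hses (j + 1)) (hP _).2 fun Q h1 h2 p => ?_
    obtain ⟨q, hq⟩ := (hQ Q h1 h2 j (p.comp (d (j + 1)).rangeRestrict)).1 (by
      ext x
      have : d (j + 1) (d j x) = 0 := (hd j).apply_apply_eq_zero x
      have h0 : (d (j + 1)).rangeRestrict (d j x) = 0 := Subtype.ext this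
      simp [h0])
    refine ⟨q, ?_⟩
    ext ⟨_, x, rfl⟩
    exact LinearMap.congr_fun hq x
  | succ k ih =>
    intro i
    obtain ⟨j, rfl⟩ : ∃ j, i = j + 1 := ⟨i - 1, by ring⟩
    exact ExtProjVanishes.right (X := ModuleCat.of A (LinearMap.range (d j))) (Y := P (j + 1))
      (hses j) (ih j) (.of_projective (hP _).2 _)

/-- A Gorenstein projective module embeds into a finitely generated projective one with Gorenstein
projective cokernel. -/
theorem IsGorensteinProjective.exists_cosyzygy {X : ModuleCat.{u} A}
    (hX : IsGorensteinProjective A X) :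
    ∃ (P X' : ModuleCat.{u} A) (f : X →ₗ[A] P) (g : P →ₗ[A] X'), Module.Finite A P ∧
      Module.Projective A P ∧ IsShortExact f g ∧ IsGorensteinProjective A X' := by
  obtain ⟨P, d, hP, hd, hQ, ⟨e⟩⟩ := hX
  have hses := isShortExact_range (hd 0)
  refine ⟨P (0 + 1), ModuleCat.of A (LinearMap.range (d (0 + 1))),
    (LinearMap.range (d 0)).subtype.comp e.toLinearMap, (d (0 + 1)).rangeRestrict,
    (hP _).1, (hP _).2, ⟨hses.injective.comp e.injective, fun y => ?_, hses.surjective⟩, ?_⟩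
  · refine (hses.exact y).trans ⟨fun ⟨x, hx⟩ => ⟨e.symm x, ?_⟩, fun ⟨x, hx⟩ => ⟨e x, hx⟩⟩
    rw [← hx]
    simp
  · exact ⟨fun i => P (i + 1), fun i => d (i + 1), fun i => hP _, fun i => hd _,
      fun Q h1 h2 i => hQ Q h1 h2 (i + 1), ⟨LinearEquiv.refl _ _⟩⟩

/-- Over a noetherian ring, a class of finitely generated modules `X` with `Ext^i(X, -) = 0` on
finitely generated projectives for `i > 0` consists of Gorenstein projective modules as soon as it
is closed under suitable cosyzygies: the syzygies needed to the left exist in any case. -/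
theorem isGorensteinProjective_of_cosyzygies [IsNoetherianRing A] (C : ModuleCat.{u} A → Prop)
    (hfin : ∀ X, C X → Module.Finite A X) (hext : ∀ X, C X → ∀ i, ExtProjVanishes X (i + 1))
    (hnext : ∀ X : ModuleCat.{u} A, C X → ∃ (P X' : ModuleCat.{u} A) (f : X →ₗ[A] P)
      (g : P →ₗ[A] X'), Module.Finite A P ∧ Module.Projective A P ∧ IsShortExact f g ∧ C X')
    {X : ModuleCat.{u} A} (hX : C X) : IsGorensteinProjective A X := by
  let D := {X : ModuleCat.{u} A // Module.Finite A X ∧ ∀ i, ExtProjVanishes X (i + 1)}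
  -- The chain of syzygies and cosyzygies of `X`; a complete resolution is spliced from it.
  let r : D → D → Prop := fun X Y => ∃ (P : ModuleCat.{u} A) (f : X.1 →ₗ[A] P) (g : P →ₗ[A] Y.1),
    (Module.Finite A P ∧ Module.Projective A P) ∧ IsShortExact f g
  obtain ⟨φ, hφX, hφ⟩ := exists_int_chain r (fun X => C X.1) (fun Y => by
      have := Y.2.1
      obtain ⟨n, π, hπ⟩ := Module.Finite.exists_fin' A Y.1
      let P := ModuleCat.of A (Fin n → A)
      let K := ModuleCat.of A (LinearMap.ker π)
      have hses : IsShortExact (X := K) (Y := P) (LinearMap.ker π).subtype π :=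
        isShortExact_subtype_ker (Y := P) hπ
      have hP : Module.Projective A P := inferInstanceAs (Module.Projective A (Fin n → A))
      exact ⟨⟨K, inferInstanceAs (Module.Finite A (LinearMap.ker π)),
        fun i => .left hses (.of_projective hP i) (Y.2.2 _)⟩, P, _, _,
        ⟨inferInstanceAs (Module.Finite A (Fin n → A)), hP⟩, hses⟩)
    (fun X hX => by
      obtain ⟨P, X', f, g, h1, h2, h3, h4⟩ := hnext X.1 hX
      exact ⟨⟨X', hfin _ h4, hext _ h4⟩, ⟨P, f, g, ⟨h1, h2⟩, h3⟩, h4⟩)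
    ⟨X, hfin X hX, hext X hX⟩ hX (0 + 1)
  choose P f g hP hfg using hφ
  have hgf (i : ℤ) (x) : g i (f i x) = 0 := (hfg i).exact.apply_apply_eq_zero x
  refine ⟨P, fun i => (f (i + 1)).comp (g i), hP, fun i y => ?_, fun Q h1 h2 i p => ?_, ⟨?_⟩⟩
  · constructor
    · intro hy
      have : g (i + 1) y = 0 := (hfg (i + 1 + 1)).injective (hy.trans (map_zero _).symm)
      obtain ⟨z, rfl⟩ := ((hfg (i + 1)).exact y).1 this
      obtain ⟨w, rfl⟩ := (hfg i).surjective z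
      exact ⟨w, rfl⟩
    · rintro ⟨w, rfl⟩
      change f (i + 1 + 1) (g (i + 1) (f (i + 1) (g i w))) = 0
      rw [hgf, map_zero]
  · constructor
    · intro hp
      obtain ⟨q, hq⟩ := (hfg (i + 1)).exists_desc p (by
        ext x
        obtain ⟨w, rfl⟩ := (hfg i).surjective x
        exact LinearMap.congr_fun hp w)
      obtain ⟨q', hq'⟩ := ((φ (i + 1 + 1 + 1)).2.2 0).exists_extension (hfg (i + 1 + 1)) h1 h2 q
      refine ⟨q', ?_⟩
      ext x
      exact (LinearMap.congr_fun hq' (g (i + 1) x)).trans (hq x)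
    · rintro ⟨q, rfl⟩
      ext x
      change q (f (i + 1 + 1) (g (i + 1) (f (i + 1) (g i x)))) = 0
      rw [hgf, map_zero, map_zero]
  · have hr : LinearMap.range ((f (0 + 1)).comp (g 0)) = LinearMap.range (f (0 + 1)) :=
      LinearMap.range_comp_of_range_eq_top _ (LinearMap.range_eq_top.2 (hfg 0).surjective)
    have e := (LinearEquiv.ofInjective (f (0 + 1)) (hfg (0 + 1)).injective).trans
      (LinearEquiv.ofEq _ _ hr.symm)
    have hXφ : X = (φ (0 + 1)).1 := by rw [hφX]
    exact (eqToIso hXφ).toLinearEquiv.trans e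

/-- Gorenstein projective modules are closed under extensions. The cosyzygy of an extension is an
extension of cosyzygies, as in the horseshoe lemma, because maps from the submodule to projectives
extend. -/
theorem IsGorensteinProjective.extension [IsNoetherianRing A] {X Y Z : ModuleCat.{u} A}
    {f : X →ₗ[A] Y} {g : Y →ₗ[A] Z} (h : IsShortExact f g) (hX : IsGorensteinProjective A X)
    (hZ : IsGorensteinProjective A Z) : IsGorensteinProjective A Y := by
  refine isGorensteinProjective_of_cosyzygies
    (fun Y => ∃ (X Z : ModuleCat.{u} A) (f : X →ₗ[A] Y) (g : Y →ₗ[A] Z), IsShortExact f g ∧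
      IsGorensteinProjective A X ∧ IsGorensteinProjective A Z) ?_ ?_ ?_ ⟨X, Z, f, g, h, hX, hZ⟩
  · rintro Y ⟨X, Z, f, g, h, hX, hZ⟩
    exact h.finite_middle hX.finite hZ.finite
  · rintro Y ⟨X, Z, f, g, h, hX, hZ⟩ i
    exact .middle h (hX.extProjVanishes i) (hZ.extProjVanishes i)
  · rintro Y ⟨X, Z, f, g, h, hX, hZ⟩
    obtain ⟨P, X', ι, π, hP1, hP2, hP, hX'⟩ := hX.exists_cosyzygy
    obtain ⟨Q, Z', κ, ρ, hQ1, hQ2, hQ, hZ'⟩ := hZ.exists_cosyzygy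
    obtain ⟨α, hα⟩ := (hZ.extProjVanishes 0).exists_extension h hP1 hP2 ι
    replace hα (x) : α (f x) = ι x := LinearMap.congr_fun hα x
    have hgf (x) : g (f x) = 0 := h.exact.apply_apply_eq_zero x
    have hκρ (x) : ρ (κ x) = 0 := hQ.exact.apply_apply_eq_zero x
    let j : Y →ₗ[A] P × Q := α.prod (κ.comp g)
    let N := LinearMap.range j
    have hj : Function.Injective j := by
      rw [← LinearMap.ker_eq_bot, LinearMap.ker_eq_bot']
      intro y hy
      have h1 : α y = 0 := congrArg Prod.fst hy
      have h2 : κ (g y) = 0 := congrArg Prod.snd hy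
      obtain ⟨x, rfl⟩ := (h.exact y).1 (hQ.injective (h2.trans (map_zero κ).symm))
      rw [hα] at h1
      rw [hP.injective (h1.trans (map_zero ι).symm), map_zero]
    let Y' := ModuleCat.of A ((P × Q) ⧸ N)
    obtain ⟨β, hβ⟩ := hP.exists_desc (W := Y') (N.mkQ.comp (LinearMap.inl A P Q)) (by
      ext x
      refine (Submodule.Quotient.mk_eq_zero N).2 ⟨f x, ?_⟩
      simp [j, hα, hgf])
    let γ : Y' →ₗ[A] Z' := N.liftQ (ρ.comp (LinearMap.snd A P Q)) (by
      rintro _ ⟨y, rfl⟩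
      simp [j, hκρ])
    refine ⟨ModuleCat.of A (P × Q), Y', j, N.mkQ, inferInstanceAs (Module.Finite A (P × Q)),
      inferInstanceAs (Module.Projective A (P × Q)),
      isShortExact_mkQ_range (Y := ModuleCat.of A (P × Q)) hj, X', Z', β, γ, ⟨?_, ?_, ?_⟩, hX', hZ'⟩
    · rw [← LinearMap.ker_eq_bot, LinearMap.ker_eq_bot']
      intro x' hx'
      obtain ⟨p, rfl⟩ := hP.surjective x'
      rw [hβ] at hx'
      obtain ⟨y, hy⟩ := (Submodule.Quotient.mk_eq_zero N).1 hx'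
      have h1 : α y = p := congrArg Prod.fst hy
      have h2 : κ (g y) = 0 := congrArg Prod.snd hy
      obtain ⟨x, rfl⟩ := (h.exact y).1 (hQ.injective (h2.trans (map_zero κ).symm))
      rw [← h1, hα]
      exact hP.exact.apply_apply_eq_zero x
    · intro z
      obtain ⟨⟨p, q⟩, rfl⟩ := Submodule.mkQ_surjective N z
      constructor
      · intro hz
        obtain ⟨z, rfl⟩ := (hQ.exact q).1 hz
        obtain ⟨y, rfl⟩ := h.surjective z
        refine ⟨π (p - α y), ?_⟩
        rw [hβ]
        refine (Submodule.Quotient.eq N).2 ⟨-y, ?_⟩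
        simp [j]
      · rintro ⟨x', hx'⟩
        rw [← hx']
        obtain ⟨p', rfl⟩ := hP.surjective x'
        rw [hβ]
        exact map_zero ρ
    · intro z
      obtain ⟨q, rfl⟩ := hQ.surjective z
      exact ⟨N.mkQ (0, q), rfl⟩

/-- `X` has a resolution `0 → G_n → ⋯ → G_0 → X → 0` by Gorenstein projective modules. -/
def HasGorensteinResolution : ℕ → ModuleCat.{u} A → Prop
  | 0, X => IsGorensteinProjective A X
  | n + 1, X => ∃ (K G : ModuleCat.{u} A) (f : K →ₗ[A] G) (g : G →ₗ[A] X),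
      IsShortExact f g ∧ IsGorensteinProjective A G ∧ HasGorensteinResolution n K

/-- The Auslander–Buchweitz hull: a module of finite Gorenstein projective dimension embeds into a
module of finite projective dimension with Gorenstein projective cokernel. -/
theorem HasGorensteinResolution.exists_hull [IsNoetherianRing A] {n : ℕ} {X : ModuleCat.{u} A}
    (hX : HasGorensteinResolution n X) :
    ∃ (H G : ModuleCat.{u} A) (f : X →ₗ[A] H) (g : H →ₗ[A] G), IsShortExact f g ∧
      Module.Finite A H ∧ (∃ k, HasProjectiveDimensionLE H k) ∧ IsGorensteinProjective A G := by
  induction n generalizing X with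
  | zero =>
    obtain ⟨P, X', f, g, h1, h2, h3, h4⟩ := IsGorensteinProjective.exists_cosyzygy hX
    have : Projective P := (IsProjective.iff_projective P).1 h2
    exact ⟨P, X', f, g, h3, h1, ⟨0, inferInstance⟩, h4⟩
  | succ n ih =>
    obtain ⟨K, G₀, f, g, hfg, hG₀, hK⟩ := hX
    obtain ⟨H₁, G₁, f', g', hfg', hH₁, ⟨k, hk⟩, hG₁⟩ := ih hK
    obtain ⟨V, a, b, c, e, hab, hce⟩ := exists_pushout hfg hfg'
    obtain ⟨P, V', j, π, hP1, hP2, hjπ, hV'⟩ := (hG₀.extension hce hG₁).exists_cosyzygy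
    let N := LinearMap.range (j.comp a)
    let H := ModuleCat.of A (P ⧸ N)
    obtain ⟨β, hβ⟩ := hab.exists_desc (W := H) (N.mkQ.comp j) (by
      ext x
      exact (Submodule.Quotient.mk_eq_zero N).2 ⟨x, rfl⟩)
    have hπj (x) : π (j x) = 0 := hjπ.exact.apply_apply_eq_zero x
    let γ : H →ₗ[A] V' := N.liftQ π (by
      rintro _ ⟨x, rfl⟩
      exact hπj _)
    have : Projective P := (IsProjective.iff_projective P).1 hP2
    obtain ⟨_, hS⟩ := (isShortExact_mkQ_range (f := j.comp a) (Y := P) (X := H₁)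
      (hjπ.injective.comp hab.injective)).exists_shortExact (Z := H)
    refine ⟨H, V', β, γ, ⟨?_, ?_, ?_⟩, inferInstanceAs (Module.Finite A (P ⧸ N)),
      ⟨k + 1, hS.hasProjectiveDimensionLT_X₃ (k + 1) hk ?_⟩, hV'⟩
    · rw [← LinearMap.ker_eq_bot, LinearMap.ker_eq_bot']
      intro x hx
      obtain ⟨v, rfl⟩ := hab.surjective x
      rw [hβ] at hx
      obtain ⟨y, hy⟩ := (Submodule.Quotient.mk_eq_zero N).1 hx
      rw [← hjπ.injective hy]
      exact hab.exact.apply_apply_eq_zero y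
    · intro z
      obtain ⟨p, rfl⟩ := Submodule.mkQ_surjective N z
      constructor
      · intro hp
        obtain ⟨v, rfl⟩ := (hjπ.exact p).1 hp
        exact ⟨b v, hβ v⟩
      · rintro ⟨x, hx⟩
        rw [← hx]
        obtain ⟨v, rfl⟩ := hab.surjective x
        rw [hβ]
        exact hπj v
    · intro z
      obtain ⟨p, rfl⟩ := hjπ.surjective z
      exact ⟨N.mkQ p, rfl⟩
    · exact (inferInstance : HasProjectiveDimensionLT P (k + 1 + 1))

/-- By the hull, extensions of a module of finite Gorenstein projective dimension by projectives
vanish above the finitistic dimension. -/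
theorem HasGorensteinResolution.extProjVanishes [IsNoetherianRing A] {n m : ℕ}
    {X : ModuleCat.{u} A} (hX : HasGorensteinResolution n X) (hA : finDim A ≤ m) {i : ℕ}
    (hi : m < i) : ExtProjVanishes X i := by
  obtain ⟨H, G, f, g, hfg, hH, hk, hG⟩ := hX.exists_hull
  have hlt : projectiveDimension H < ⊤ := ((projectiveDimension_ne_top_iff H).2 hk).lt_top
  have hpd : projectiveDimension H ≤ m :=
    (le_iSup₂_of_le H hH (le_iSup_of_le hlt le_rfl) : projectiveDimension H ≤ finDim A).trans hA
  have := (projectiveDimension_le_iff H m).1 hpd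
  refine .left hfg (fun Q _ _ => ?_) (hG.extProjVanishes i)
  exact HasProjectiveDimensionLT.subsingleton H (m + 1) i hi Q

/-- A module of finite Gorenstein projective dimension without higher extensions by projectives is
Gorenstein projective. Closure under direct summands is an assumption here, although it holds in
general. -/
theorem HasGorensteinResolution.isGorensteinProjective [IsNoetherianRing A]
    (hretr : ∀ (X Y : ModuleCat.{u} A) (s : X →ₗ[A] Y) (r : Y →ₗ[A] X), r.comp s = LinearMap.id →
      IsGorensteinProjective A Y → IsGorensteinProjective A X) {n : ℕ}
    {X : ModuleCat.{u} A} (hX : HasGorensteinResolution n X)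
    (hext : ∀ i, ExtProjVanishes X (i + 1)) : IsGorensteinProjective A X := by
  induction n generalizing X with
  | zero => exact hX
  | succ n ih =>
    obtain ⟨K, G, f, g, hfg, hG, hK⟩ := hX
    have hK' := ih hK fun i => .left hfg (hG.extProjVanishes i) (hext _)
    obtain ⟨P, K', f', g', h1, h2, hfg', hK''⟩ := hK'.exists_cosyzygy
    obtain ⟨V, a, b, c, e, hab, hce⟩ := exists_pushout hfg hfg'
    -- `Ext^1(X, P) = 0` splits `0 → P → V → X → 0`, so `X` is a direct summand of `V`.
    obtain ⟨q, hq⟩ := (hext 0).exists_extension hab h1 h2 LinearMap.id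
    obtain ⟨s, hs⟩ := hab.exists_section hq
    exact hretr X V s b hs (hG.extension hce hK'')

/-- If `fin.dim A ≤ m`, the `m`-th syzygies of a finite exact complex of Gorenstein projective
modules are Gorenstein projective. -/
theorem isGorensteinProjective_range [IsNoetherianRing A]
    (hretr : ∀ (X Y : ModuleCat.{u} A) (s : X →ₗ[A] Y) (r : Y →ₗ[A] X), r.comp s = LinearMap.id →
      IsGorensteinProjective A Y → IsGorensteinProjective A X) {m : ℕ} (hA : finDim A ≤ m)
    (G : ℕ → ModuleCat.{u} A) (d : ∀ i, G (i + 1) →ₗ[A] G i)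
    (hG : ∀ i, IsGorensteinProjective A (G i)) (hd : ∀ i, Function.Exact (d (i + 1)) (d i))
    {N : ℕ} (hN : ∀ i, N ≤ i → Subsingleton (G i)) {k : ℕ} (hk : m ≤ k + 1) :
    IsGorensteinProjective A (ModuleCat.of A (LinearMap.range (d k))) := by
  -- `X i` is the syzygy number `i + 1` of the cokernel `Y` of `d 0`.
  let X : ℕ → ModuleCat.{u} A := fun i => ModuleCat.of A (LinearMap.range (d i))
  have hses (i : ℕ) : IsShortExact (X := X (i + 1)) (Y := G (i + 1)) (Z := X i)
      (LinearMap.range (d (i + 1))).subtype (d i).rangeRestrict := isShortExact_range (hd i)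
  have hres (j : ℕ) : ∀ i, N ≤ i + j → HasGorensteinResolution j (X i) := by
    induction j with
    | zero =>
      intro i hi
      have := hN i hi
      have : Subsingleton (X i) := inferInstanceAs (Subsingleton (LinearMap.range (d i)))
      exact hretr (X i) (G i) 0 0 (Subsingleton.elim _ _) (hG i)
    | succ j ih => exact fun i hi => ⟨_, _, _, _, hses i, hG _, ih (i + 1) (by lia)⟩
  let Y : ModuleCat.{u} A := ModuleCat.of A (G 0 ⧸ LinearMap.range (d 0))
  have hY : IsShortExact (X := X 0) (Y := G 0) (Z := Y) (LinearMap.range (d 0)).subtype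
      (LinearMap.range (d 0)).mkQ := ⟨Subtype.val_injective,
    LinearMap.exact_subtype_mkQ _, Submodule.mkQ_surjective _⟩
  have hYres : HasGorensteinResolution (N + 1) Y := ⟨_, _, _, _, hY, hG 0, hres N 0 (by lia)⟩
  have hext (i : ℕ) : ∀ j, m ≤ i + 1 + j → ExtProjVanishes (X i) (j + 1) := by
    induction i with
    | zero =>
      intro j hj
      exact .left (X := X 0) (Y := G 0) (Z := Y) hY ((hG 0).extProjVanishes j)
        (hYres.extProjVanishes hA (by lia))
    | succ i ih =>
      exact fun j hj => .left (hses i) ((hG _).extProjVanishes j) (ih _ (by lia))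
  exact (hres N k (by lia)).isGorensteinProjective hretr fun i => hext k i (by lia)

end GorensteinProjective

/-! ### The balanced tensor product with a finitely generated projective module -/

section Balanced

variable (B : Type u) [Ring B]
variable {T T' T'' Y Y' Y'' : Type u} [AddCommGroup T] [Module Bᵐᵒᵖ T] [AddCommGroup T']
  [Module Bᵐᵒᵖ T'] [AddCommGroup T''] [Module Bᵐᵒᵖ T''] [AddCommGroup Y] [Module B Y]
  [AddCommGroup Y'] [Module B Y'] [AddCommGroup Y''] [Module B Y'']

theorem BalancedTensor.add_tmul (t t' : T) (y : Y) :
    BalancedTensor.tmul B (t + t') y = BalancedTensor.tmul B t y + BalancedTensor.tmul B t' y := by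
  rw [BalancedTensor.tmul, TensorProduct.add_tmul, map_add]
  rfl

theorem BalancedTensor.smul_tmul (t : T) (b : B) (y : Y) :
    BalancedTensor.tmul B (MulOpposite.op b • t) y = BalancedTensor.tmul B t (b • y) := by
  rw [BalancedTensor.tmul, BalancedTensor.tmul, ← sub_eq_zero, ← map_sub]
  exact (QuotientAddGroup.eq_zero_iff _).2 (AddSubgroup.subset_closure ⟨t, b, y, rfl⟩)

theorem BalancedTensor.map_map (f : T →ₗ[Bᵐᵒᵖ] T') (f' : T' →ₗ[Bᵐᵒᵖ] T'') (g : Y →ₗ[B] Y')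
    (g' : Y' →ₗ[B] Y'') (z : BalancedTensor B T Y) :
    BalancedTensor.map B f' g' (BalancedTensor.map B f g z) =
      BalancedTensor.map B (f'.comp f) (g'.comp g) z :=
  DFunLike.congr_fun (BalancedTensor.hom_ext B
    (p := (BalancedTensor.map B f' g').comp (BalancedTensor.map B f g))
    (q := BalancedTensor.map B (f'.comp f) (g'.comp g)) fun _ _ => rfl) z

theorem BalancedTensor.map_id_id (z : BalancedTensor B T Y) :
    BalancedTensor.map B (LinearMap.id : T →ₗ[Bᵐᵒᵖ] T) (LinearMap.id : Y →ₗ[B] Y) z = z :=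
  DFunLike.congr_fun (BalancedTensor.hom_ext B
    (p := BalancedTensor.map B LinearMap.id LinearMap.id) (q := AddMonoidHom.id _) fun _ _ => rfl) z

variable (T) in
/-- The map `T ⊗_B Bⁿ → Tⁿ` sending `t ⊗ (b_i)` to `(t b_i)`. -/
def BalancedTensor.piMap (n : ℕ) : BalancedTensor B T (Fin n → B) →+ (Fin n → T) :=
  QuotientAddGroup.lift (balancedRelations B T (Fin n → B))
    (TensorProduct.liftAddHom
      (AddMonoidHom.mk' (fun t => AddMonoidHom.mk' (fun y i => MulOpposite.op (y i) • t)
          fun y y' => by ext i; simp [add_smul])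
        fun t t' => by ext y i; simp)
      fun r t y => funext fun i =>
        (smul_comm _ r t).trans (smul_assoc r (MulOpposite.op (y i)) t).symm) (by
    rw [balancedRelations, AddSubgroup.closure_le]
    rintro _ ⟨t, b, y, rfl⟩
    rw [SetLike.mem_coe, AddMonoidHom.mem_ker, map_sub, sub_eq_zero]
    ext i
    simp [smul_smul])

@[simp]
theorem BalancedTensor.piMap_tmul {n : ℕ} (t : T) (y : Fin n → B) (i : Fin n) :
    BalancedTensor.piMap B T n (BalancedTensor.tmul B t y) i = MulOpposite.op (y i) • t := rfl

variable (T) in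
theorem BalancedTensor.piMap_bijective (n : ℕ) :
    Function.Bijective (BalancedTensor.piMap B T n) := by
  let ψ : (Fin n → T) →+ BalancedTensor B T (Fin n → B) :=
    AddMonoidHom.mk' (fun x => ∑ i, BalancedTensor.tmul B (x i) (Pi.single i 1)) fun x x' => by
      simp [BalancedTensor.add_tmul, Finset.sum_add_distrib]
  let tm (t : T) : (Fin n → B) →+ BalancedTensor B T (Fin n → B) :=
    AddMonoidHom.mk' (BalancedTensor.tmul B t) (BalancedTensor.tmul_add B t)
  have h1 : ψ.comp (BalancedTensor.piMap B T n) = AddMonoidHom.id _ := by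
    refine BalancedTensor.hom_ext B fun t y => ?_
    change ∑ i, BalancedTensor.tmul B (MulOpposite.op (y i) • t) (Pi.single i (1 : B)) = tm t y
    simp only [BalancedTensor.smul_tmul]
    rw [← (Finset.univ_sum_single y), map_sum]
    refine Finset.sum_congr rfl fun i _ => ?_
    change _ = BalancedTensor.tmul B t _
    rw [← Pi.single_smul, smul_eq_mul, mul_one, Finset.univ_sum_single]
  have h2 (x : Fin n → T) : BalancedTensor.piMap B T n (ψ x) = x := by
    change BalancedTensor.piMap B T n (∑ i, BalancedTensor.tmul B (x i) (Pi.single i 1)) = x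
    ext j
    rw [map_sum, Finset.sum_apply, Finset.sum_eq_single j]
    · simp
    · intro i _ hij
      simp [Pi.single_eq_of_ne hij.symm]
    · simp
  exact ⟨Function.LeftInverse.injective (g := ψ) (DFunLike.congr_fun h1),
    Function.RightInverse.surjective (g := ψ) h2⟩

theorem BalancedTensor.piMap_map {n : ℕ} (f : T →ₗ[Bᵐᵒᵖ] T')
    (z : BalancedTensor B T (Fin n → B)) :
    BalancedTensor.piMap B T' n (BalancedTensor.map B f LinearMap.id z) =
      fun i => f (BalancedTensor.piMap B T n z i) := by
  let φ : (Fin n → T) →+ (Fin n → T') := f.toAddMonoidHom.compLeft (Fin n)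
  exact DFunLike.congr_fun (BalancedTensor.hom_ext B
    (p := (BalancedTensor.piMap B T' n).comp (BalancedTensor.map B f LinearMap.id))
    (q := φ.comp (BalancedTensor.piMap B T n)) fun t y => by
      ext i
      exact (f.map_smul (MulOpposite.op (y i)) t).symm) z

theorem exists_retract_pi {Q : Type u} [AddCommGroup Q] [Module B Q] (h1 : Module.Finite B Q)
    (h2 : Module.Projective B Q) : ∃ (n : ℕ) (s : Q →ₗ[B] (Fin n → B)) (r : (Fin n → B) →ₗ[B] Q),
      r.comp s = LinearMap.id := by
  obtain ⟨n, r, hr⟩ := Module.Finite.exists_fin' B Q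
  obtain ⟨s, hs⟩ := Module.projective_lifting_property r LinearMap.id hr
  exact ⟨n, s, r, hs⟩

/-- Finitely generated projective modules are flat, as direct summands of `Bⁿ`. -/
theorem isFlatLeft_of_projective {F : ModuleCat.{u} B} (h1 : Module.Finite B F)
    (h2 : Module.Projective B F) : IsFlatLeft B F := by
  intro X X' f hf
  obtain ⟨n, s, r, hrs⟩ := exists_retract_pi B h1 h2
  have hfree : Function.Injective
      (BalancedTensor.map B f (LinearMap.id : (Fin n → B) →ₗ[B] (Fin n → B))) := by
    intro z z' hz
    refine (BalancedTensor.piMap_bijective B X n).1 (funext fun i => hf ?_)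
    have := congrArg (fun w => BalancedTensor.piMap B X' n w i) hz
    simpa only [BalancedTensor.piMap_map] using this
  intro z z' hz
  have h := congrArg (BalancedTensor.map B (LinearMap.id : X' →ₗ[Bᵐᵒᵖ] X') s) hz
  simp only [BalancedTensor.map_map, LinearMap.id_comp, LinearMap.comp_id] at h
  have h' (w : BalancedTensor B X F) : BalancedTensor.map B f s w =
      BalancedTensor.map B f LinearMap.id (BalancedTensor.map B LinearMap.id s w) := by
    rw [BalancedTensor.map_map, LinearMap.id_comp, LinearMap.comp_id]
  rw [h', h'] at h
  have := congrArg (BalancedTensor.map B (LinearMap.id : X →ₗ[Bᵐᵒᵖ] X) r) (hfree h)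
  simpa only [BalancedTensor.map_map, LinearMap.id_comp, hrs, BalancedTensor.map_id_id] using this

end Balanced

/-! ### Tensoring with a bimodule -/

section Bimodule

variable {A : Type u} [Ring A] {B : Type u} [Ring B]
variable {M : Type u} [AddCommGroup M] [Module A M] [Module Bᵐᵒᵖ M] [SMulCommClass A Bᵐᵒᵖ M]
variable {Y Y' : Type u} [AddCommGroup Y] [Module B Y] [AddCommGroup Y'] [Module B Y']

/-- `M ⊗_B Y` is a left `A`-module for an `A`-`B`-bimodule `M`, by `a (m ⊗ y) = (a m) ⊗ y`. -/
instance BalancedTensor.leftModule : Module A (BalancedTensor B M Y) :=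
  Module.compHom _
    ({ toFun := fun a => BalancedTensor.map B (DistribSMul.toLinearMap Bᵐᵒᵖ M a) LinearMap.id
       map_one' := BalancedTensor.hom_ext _ fun m y =>
        congrArg (fun x => BalancedTensor.tmul B x y) (one_smul A m)
       map_mul' := fun a a' => BalancedTensor.hom_ext _ fun m y =>
        congrArg (fun x => BalancedTensor.tmul B x y) (mul_smul a a' m)
       map_zero' := BalancedTensor.hom_ext _ fun m y => by
        have h : BalancedTensor.tmul B ((0 : A) • m) y = 0 := by
          rw [zero_smul, BalancedTensor.tmul, TensorProduct.zero_tmul, map_zero]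
        exact h
       map_add' := fun a a' => BalancedTensor.hom_ext _ fun m y => by
        have h : BalancedTensor.tmul B ((a + a') • m) y =
            BalancedTensor.tmul B (a • m) y + BalancedTensor.tmul B (a' • m) y := by
          rw [add_smul, BalancedTensor.add_tmul]
        exact h } : A →+* AddMonoid.End (BalancedTensor B M Y))

variable (A M) in
/-- The `A`-linear map `M ⊗_B Y → M ⊗_B Y'` induced by a `B`-linear map `Y → Y'`. -/
def BalancedTensor.lmap (g : Y →ₗ[B] Y') : BalancedTensor B M Y →ₗ[A] BalancedTensor B M Y' where
  toFun := BalancedTensor.map B LinearMap.id g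
  map_add' := map_add _
  map_smul' a z := by
    change BalancedTensor.map B LinearMap.id g
      (BalancedTensor.map B (DistribSMul.toLinearMap Bᵐᵒᵖ M a) LinearMap.id z) =
      BalancedTensor.map B (DistribSMul.toLinearMap Bᵐᵒᵖ M a) LinearMap.id
        (BalancedTensor.map B LinearMap.id g z)
    rw [BalancedTensor.map_map, BalancedTensor.map_map]
    rfl

theorem BalancedTensor.lmap_comp_eq_id {s : Y →ₗ[B] Y'} {r : Y' →ₗ[B] Y}
    (h : r.comp s = LinearMap.id) :
    (BalancedTensor.lmap A M r).comp (BalancedTensor.lmap A M s) = LinearMap.id := by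
  refine LinearMap.ext fun z => ?_
  change BalancedTensor.map B LinearMap.id r (BalancedTensor.map B LinearMap.id s z) = z
  rw [BalancedTensor.map_map, h]
  exact BalancedTensor.map_id_id B z

variable (A B M) in
/-- The isomorphism `M ⊗_B Bⁿ ≅ Mⁿ` of `A`-modules. -/
def BalancedTensor.piEquiv (n : ℕ) : BalancedTensor B M (Fin n → B) ≃ₗ[A] (Fin n → M) :=
  LinearEquiv.ofBijective
    ({ toFun := BalancedTensor.piMap B M n
       map_add' := map_add _
       map_smul' := fun a z =>
        BalancedTensor.piMap_map B (DistribSMul.toLinearMap Bᵐᵒᵖ M a) z } :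
      BalancedTensor B M (Fin n → B) →ₗ[A] (Fin n → M))
    (BalancedTensor.piMap_bijective B M n)

variable (A B M) in
/-- `Hom_A(M, Z)` is a left `B`-module for an `A`-`B`-bimodule `M`, by `(b f)(m) = f (m b)`. -/
@[reducible]
def bimoduleHom (Z : Type u) [AddCommGroup Z] [Module A Z] : Module B (M →ₗ[A] Z) where
  smul b f :=
    { toFun := fun m => f (MulOpposite.op b • m)
      map_add' := fun m m' => by rw [smul_add, map_add]
      map_smul' := fun a m => by rw [← smul_comm a (MulOpposite.op b) m, map_smul]; rfl }
  one_smul f := LinearMap.ext fun m => congrArg f (one_smul Bᵐᵒᵖ m)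
  mul_smul b b' f := LinearMap.ext fun m =>
    congrArg f (mul_smul (MulOpposite.op b') (MulOpposite.op b) m)
  smul_zero b := rfl
  smul_add b f f' := rfl
  add_smul b b' f := LinearMap.ext fun m =>
    (congrArg f (add_smul (MulOpposite.op b) (MulOpposite.op b') m)).trans (map_add f _ _)
  zero_smul f := LinearMap.ext fun m => (congrArg f (zero_smul Bᵐᵒᵖ m)).trans (map_zero f)

attribute [local instance] bimoduleHom

variable (A M Y) in
/-- The unit `Y → Hom_A(M, M ⊗_B Y)` of the tensor-hom adjunction. -/
def BalancedTensor.unit : Y →ₗ[B] (M →ₗ[A] BalancedTensor B M Y) where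
  toFun y :=
    { toFun := fun m => BalancedTensor.tmul B m y
      map_add' := fun m m' => BalancedTensor.add_tmul B m m' y
      map_smul' := fun _ _ => rfl }
  map_add' y y' := LinearMap.ext fun m => BalancedTensor.tmul_add B m y y'
  map_smul' b y := LinearMap.ext fun m => (BalancedTensor.smul_tmul B m b y).symm

theorem BalancedTensor.lmap_comp_unit (g : Y →ₗ[B] Y') (y : Y) :
    (BalancedTensor.lmap A M g).comp (BalancedTensor.unit A M Y y) =
      BalancedTensor.unit A M Y' (g y) := rfl

variable (A B M) in
/-- `B` acts from the right as the full endomorphism ring of the left `A`-module `M`: right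
multiplication is a bijection from `B` to the `A`-linear endomorphisms of `M`, stated as
faithfulness and surjectivity. -/
def IsEndBimodule : Prop :=
  (∀ b : B, (∀ m : M, MulOpposite.op b • m = 0) → b = 0) ∧
    ∀ f : M →ₗ[A] M, ∃ b : B, ∀ m, MulOpposite.op b • m = f m

theorem BalancedTensor.unit_pi_bijective (hM : IsEndBimodule A B M) (n : ℕ) :
    Function.Bijective (BalancedTensor.unit A (B := B) M (Fin n → B)) := by
  constructor
  · rw [← LinearMap.ker_eq_bot, LinearMap.ker_eq_bot']
    intro y hy
    ext i
    refine hM.1 _ fun m => ?_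
    have h0 : BalancedTensor.unit A M (Fin n → B) y m = 0 := LinearMap.congr_fun hy m
    have h1 : BalancedTensor.piEquiv A B M n (BalancedTensor.unit A M (Fin n → B) y m) = 0 := by
      rw [h0, map_zero]
    exact congrFun h1 i
  · intro h
    choose b hb using fun i => hM.2 ((LinearMap.proj i).comp
      ((BalancedTensor.piEquiv A B M n).toLinearMap.comp h))
    exact ⟨b, LinearMap.ext fun m => (BalancedTensor.piEquiv A B M n).injective
      (funext fun i => hb i m)⟩

/-- If `B = End_A M`, the unit `Y → Hom_A(M, M ⊗_B Y)` is an isomorphism at all finitely generated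
projective `Y`, since it is one at `Y = B`. -/
theorem BalancedTensor.unit_bijective (hM : IsEndBimodule A B M) (h1 : Module.Finite B Y)
    (h2 : Module.Projective B Y) : Function.Bijective (BalancedTensor.unit A (B := B) M Y) := by
  obtain ⟨n, s, r, hrs⟩ := exists_retract_pi B h1 h2
  have hbij := BalancedTensor.unit_pi_bijective hM n
  constructor
  · intro y y' h
    have := congrArg (BalancedTensor.lmap A M s).comp h
    rw [BalancedTensor.lmap_comp_unit, BalancedTensor.lmap_comp_unit] at this
    have := congrArg r (hbij.1 this)
    rwa [← LinearMap.comp_apply, ← LinearMap.comp_apply, hrs] at this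
  · intro h
    obtain ⟨y, hy⟩ := hbij.2 ((BalancedTensor.lmap A M s).comp h)
    refine ⟨r y, ?_⟩
    rw [← BalancedTensor.lmap_comp_unit, hy, ← LinearMap.comp_assoc,
      BalancedTensor.lmap_comp_eq_id hrs, LinearMap.id_comp]

end Bimodule

/-! ### Additive closures -/

section AdditiveClosure

variable {A : Type u} [Ring A]

theorem IsInAdd.of_retract {E X Y : ModuleCat.{u} A} {s : X →ₗ[A] Y} {r : Y →ₗ[A] X}
    (h : r.comp s = LinearMap.id) (hY : IsInAdd A E Y) : IsInAdd A E X := by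
  obtain ⟨n, s', r', h'⟩ := hY
  refine ⟨n, s'.comp s, r.comp r', ?_⟩
  rw [LinearMap.comp_assoc, ← LinearMap.comp_assoc s, h', LinearMap.id_comp, h]

theorem IsInAdd.pi {E X : ModuleCat.{u} A} (hX : IsInAdd A E X) (n : ℕ) :
    IsInAdd A E (ModuleCat.of A (Fin n → X)) := by
  obtain ⟨k, s, r, h⟩ := hX
  let e : (Fin n → Fin k → E) ≃ₗ[A] (Fin (n * k) → E) :=
    (LinearEquiv.curry A E (Fin n) (Fin k)).symm.trans
      (LinearEquiv.funCongrLeft A E finProdFinEquiv.symm)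
  refine ⟨n * k, e.toLinearMap.comp (s.compLeft (Fin n)), (r.compLeft (Fin n)).comp
    e.symm.toLinearMap, ?_⟩
  refine LinearMap.ext fun x => funext fun i => ?_
  have := LinearMap.congr_fun h (x i)
  simpa using this

theorem hasProjectiveDimensionLT_pi {X : ModuleCat.{u} A} {d : ℕ}
    (hX : HasProjectiveDimensionLT X d) (n : ℕ) :
    HasProjectiveDimensionLT (ModuleCat.of A (Fin n → X)) d := by
  induction n with
  | zero =>
    have : HasProjectiveDimensionLT (ModuleCat.of A (Fin 0 → X)) 0 :=
      (ModuleCat.isZero_of_subsingleton _).hasProjectiveDimensionLT_zero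
    exact hasProjectiveDimensionLT_of_ge _ 0 d (Nat.zero_le d)
  | succ n ih =>
    have h : IsShortExact (LinearMap.inl A X (Fin n → X)) (LinearMap.snd A X (Fin n → X)) :=
      ⟨LinearMap.inl_injective, .inl_snd, LinearMap.snd_surjective⟩
    obtain ⟨_, hS⟩ := h.exists_shortExact (Y := ModuleCat.of A (X × (Fin n → X)))
      (Z := ModuleCat.of A (Fin n → X))
    have := hS.hasProjectiveDimensionLT_X₂ d hX ih
    exact hasProjectiveDimensionLT_of_iso
      (Fin.consLinearEquiv A fun _ : Fin (n + 1) => X).toModuleIso d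

end AdditiveClosure

section BimoduleClosure

variable {A : Type u} [Ring A] {B : Type u} [Ring B]
variable {M : ModuleCat.{u} A} [Module Bᵐᵒᵖ M] [SMulCommClass A Bᵐᵒᵖ M]

theorem BalancedTensor.isInAdd {E : ModuleCat.{u} A} (hM : IsInAdd A E M)
    {Q : ModuleCat.{u} B} (h1 : Module.Finite B Q) (h2 : Module.Projective B Q) :
    IsInAdd A E (ModuleCat.of A (BalancedTensor B M Q)) := by
  obtain ⟨n, s, r, hrs⟩ := exists_retract_pi B h1 h2
  let e := BalancedTensor.piEquiv A B M n
  refine .of_retract (Y := ModuleCat.of A (Fin n → M))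
    (s := e.toLinearMap.comp (BalancedTensor.lmap A M s))
    (r := (BalancedTensor.lmap A M r).comp e.symm.toLinearMap) ?_ (hM.pi n)
  refine LinearMap.ext fun z => ?_
  have h := LinearMap.congr_fun (BalancedTensor.lmap_comp_eq_id (A := A) (M := M) hrs) z
  refine Eq.trans ?_ h
  exact congrArg (BalancedTensor.lmap A M r) (e.symm_apply_apply _)

attribute [local instance] bimoduleHom

/-- `pd Hom_A(M, Z) ≤ pd Hom_A(M, E)` for `Z` in `add E`. -/
theorem hasProjectiveDimensionLT_hom {E Z : ModuleCat.{u} A} (hZ : IsInAdd A E Z) {d : ℕ}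
    (hd : HasProjectiveDimensionLT (ModuleCat.of B (M →ₗ[A] E)) d) :
    HasProjectiveDimensionLT (ModuleCat.of B (M →ₗ[A] Z)) d := by
  obtain ⟨n, s, r, h⟩ := hZ
  let σ : (M →ₗ[A] Z) →ₗ[B] (Fin n → (M →ₗ[A] E)) :=
    { toFun := fun f i => (LinearMap.proj i).comp (s.comp f)
      map_add' := fun f f' => by ext i m; simp
      map_smul' := fun b f => rfl }
  let ρ : (Fin n → (M →ₗ[A] E)) →ₗ[B] (M →ₗ[A] Z) :=
    { toFun := fun f => r.comp (LinearMap.pi f)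
      map_add' := fun f f' => LinearMap.ext fun m => map_add r _ _
      map_smul' := fun b f => rfl }
  have := hasProjectiveDimensionLT_pi hd n
  refine Retract.hasProjectiveDimensionLT (Y := ModuleCat.of B (Fin n → (M →ₗ[A] E)))
    ⟨ModuleCat.ofHom σ, ModuleCat.ofHom ρ, ?_⟩ d
  refine ModuleCat.hom_ext (LinearMap.ext fun f => LinearMap.ext fun m => ?_)
  exact LinearMap.congr_fun h (f m)

end BimoduleClosure

/-! ### The endomorphism algebra -/

section EndAlg

variable (A : Type u) [Ring A] (M : Type u) [AddCommGroup M] [Module A M]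

instance EndAlg.smulCommClass : SMulCommClass A (EndAlg A M)ᵐᵒᵖ M :=
  ⟨fun a b m => (map_smul (DomMulAct.mk.symm b.unop) a m).symm⟩

theorem EndAlg.isEndBimodule : IsEndBimodule A (EndAlg A M) M :=
  ⟨fun _ hb => DomMulAct.mk.symm.injective (LinearMap.ext hb),
    fun f => ⟨DomMulAct.mk f, fun _ => rfl⟩⟩

/-- `End_A M` is a noetherian ring, since it is a submodule of the noetherian `R`-module
`End_R M`. -/
theorem EndAlg.isNoetherianRing (R : Type*) [CommRing R] [IsNoetherianRing R] [Algebra R A]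
    [Module.Finite R A] [Module.Finite A M] : IsNoetherianRing (EndAlg A M) := by
  let _ : Module R M := Module.compHom M (algebraMap R A)
  have : IsScalarTower R A M := .of_algebraMap_smul fun _ _ => rfl
  have : Module.Finite R M := .trans A M
  have : SMulCommClass A R M := IsScalarTower.to_smulCommClass'
  have : Module.Finite R (M →ₗ[R] M) := inferInstance
  have : IsNoetherian R (M →ₗ[A] M) :=
    isNoetherian_of_injective (LinearMap.restrictScalarsₗ R A M M R)
      (LinearMap.restrictScalars_injective R)
  have : IsNoetherian R (Module.End A M)ᵐᵒᵖ :=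
    isNoetherian_of_linearEquiv (MulOpposite.opLinearEquiv R)
  have : IsNoetherianRing (Module.End A M)ᵐᵒᵖ := isNoetherian_of_tower R this
  exact this

end EndAlg

/-! ### Resolutions by finitely generated projective modules -/

section Resolution

variable {B : Type u} [Ring B]

/-- A sequence of short exact sequences `0 → K (i + 1) → P i → K i → 0` of finitely generated
modules with `P i` projective: the syzygies of `K 0` in a resolution by the modules `P i`. -/
structure SyzygySequence (K P : ℕ → ModuleCat.{u} B) (f : ∀ i, K (i + 1) →ₗ[B] P i)
    (g : ∀ i, P i →ₗ[B] K i) : Prop where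
  finite_syzygy (i : ℕ) : Module.Finite B (K i)
  finite (i : ℕ) : Module.Finite B (P i)
  projective (i : ℕ) : Module.Projective B (P i)
  isShortExact (i : ℕ) : IsShortExact (f i) (g i)

/-- A finitely generated module over a noetherian ring has a resolution by finitely generated
projectives that stops at the first projective syzygy. -/
theorem exists_syzygySequence [IsNoetherianRing B] (Y : ModuleCat.{u} B)
    (hY : Module.Finite B Y) : ∃ (K P : ℕ → ModuleCat.{u} B) (f : ∀ i, K (i + 1) →ₗ[B] P i)
      (g : ∀ i, P i →ₗ[B] K i), K 0 = Y ∧ SyzygySequence K P f g ∧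
        ∀ i, Module.Projective B (K i) → Subsingleton (K (i + 1)) := by
  have step (X : {X : ModuleCat.{u} B // Module.Finite B X}) :
      ∃ (X' : {X : ModuleCat.{u} B // Module.Finite B X}) (P : ModuleCat.{u} B) (f : X'.1 →ₗ[B] P)
        (g : P →ₗ[B] X.1), Module.Finite B P ∧ Module.Projective B P ∧ IsShortExact f g ∧
          (Module.Projective B X.1 → Subsingleton X'.1) := by
    obtain ⟨X, hX⟩ := X
    by_cases h : Module.Projective B X
    · refine ⟨⟨ModuleCat.of B PUnit.{u + 1}, inferInstanceAs (Module.Finite B PUnit.{u + 1})⟩, X, 0,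
        LinearMap.id, hX, h, ⟨fun _ _ _ => rfl, fun x => ?_, Function.surjective_id⟩,
        fun _ => inferInstanceAs (Subsingleton PUnit.{u + 1})⟩
      exact ⟨fun hx => ⟨0, hx.symm⟩, fun ⟨_, hx⟩ => hx.symm⟩
    · obtain ⟨n, π, hπ⟩ := Module.Finite.exists_fin' B X
      exact ⟨⟨ModuleCat.of B (LinearMap.ker π),
          inferInstanceAs (Module.Finite B (LinearMap.ker π))⟩,
        ModuleCat.of B (Fin n → B), (LinearMap.ker π).subtype, π,
        inferInstanceAs (Module.Finite B (Fin n → B)),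
        inferInstanceAs (Module.Projective B (Fin n → B)),
        isShortExact_subtype_ker (Y := ModuleCat.of B (Fin n → B)) hπ, fun h' => absurd h' h⟩
  choose s P f g h1 h2 h3 h4 using step
  let K : ℕ → {X : ModuleCat.{u} B // Module.Finite B X} :=
    fun i => Nat.rec ⟨Y, hY⟩ (fun _ X => s X) i
  exact ⟨fun i => (K i).1, fun i => P (K i), fun i => f (K i), fun i => g (K i), rfl,
    ⟨fun i => (K i).2, fun i => h1 _, fun i => h2 _, fun i => h3 _⟩, fun i => h4 _⟩

namespace SyzygySequence

variable {K P : ℕ → ModuleCat.{u} B} {f : ∀ i, K (i + 1) →ₗ[B] P i} {g : ∀ i, P i →ₗ[B] K i}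

/-- Dimension shifting: `pd K 0 ≤ d + i` if and only if `pd K i ≤ d`. -/
theorem hasProjectiveDimensionLT_iff (h : SyzygySequence K P f g) (i d : ℕ) :
    HasProjectiveDimensionLT (K 0) (d + 1 + i) ↔ HasProjectiveDimensionLT (K i) (d + 1) := by
  induction i generalizing d with
  | zero => rfl
  | succ i ih =>
    obtain ⟨_, hS⟩ := (h.isShortExact i).exists_shortExact
    have hP : Projective (P i) := (IsProjective.iff_projective (P i)).1 (h.projective i)
    rw [show d + 1 + (i + 1) = (d + 1) + 1 + i by lia, ih]
    exact hS.hasProjectiveDimensionLT_X₃_iff d hP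

/-- A projective syzygy bounds the flat dimension. -/
theorem flatDimLE (h : SyzygySequence K P f g) (n : ℕ) :
    ∀ i, Module.Projective B (K (i + n)) → FlatDimLE B n (K i) := by
  induction n with
  | zero => exact fun i hi => isFlatLeft_of_projective B (h.finite_syzygy i) hi
  | succ n ih =>
    refine fun i hi => ⟨K (i + 1), P i, f i, g i, (h.isShortExact i).injective,
      (h.isShortExact i).exact, (h.isShortExact i).surjective,
      isFlatLeft_of_projective B (h.finite i) (h.projective i), ih (i + 1) ?_⟩
    rwa [show i + 1 + n = i + (n + 1) by lia]

theorem apply_apply (h : SyzygySequence K P f g) (i : ℕ) (x : K (i + 1)) : g i (f i x) = 0 :=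
  (h.isShortExact i).exact.apply_apply_eq_zero x

theorem exact (h : SyzygySequence K P f g) (i : ℕ) :
    Function.Exact ((f (i + 1)).comp (g (i + 2))) ((f i).comp (g (i + 1))) := by
  intro x
  constructor
  · intro hx
    have h0 : g (i + 1) x = 0 := (h.isShortExact i).injective (hx.trans (map_zero _).symm)
    obtain ⟨y, rfl⟩ := ((h.isShortExact (i + 1)).exact x).1 h0
    obtain ⟨z, rfl⟩ := (h.isShortExact (i + 2)).surjective y
    exact ⟨z, rfl⟩
  · rintro ⟨z, rfl⟩
    change f i (g (i + 1) (f (i + 1) (g (i + 2) z))) = 0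
    rw [h.apply_apply, map_zero]

/-- The chain complex with terms `P i`. -/
def complex (h : SyzygySequence K P f g) : ChainComplex (ModuleCat.{u} B) ℕ :=
  ChainComplex.of P (fun i => (ModuleCat.ofHom ((f i).comp (g (i + 1))) : P (i + 1) ⟶ P i))
    fun i => ModuleCat.hom_ext (h.exact i).linearMap_comp_eq_zero

theorem complex_d (h : SyzygySequence K P f g) (i : ℕ) :
    h.complex.d (i + 1) i = (ModuleCat.ofHom ((f i).comp (g (i + 1))) : P (i + 1) ⟶ P i) :=
  ChainComplex.of_d P (fun i => (ModuleCat.ofHom ((f i).comp (g (i + 1))) : P (i + 1) ⟶ P i)) i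

theorem complex_exactAt (h : SyzygySequence K P f g) (i : ℕ) : h.complex.ExactAt (i + 1) := by
  rw [HomologicalComplex.exactAt_iff' _ (i + 1 + 1) (i + 1) i (by simp) (by simp),
    ShortComplex.ShortExact.moduleCat_exact_iff_function_exact]
  change Function.Exact (h.complex.d (i + 1 + 1) (i + 1)) (h.complex.d (i + 1) i)
  rw [complex_d, complex_d]
  exact h.exact i

theorem complex_d_comp (h : SyzygySequence K P f g) :
    h.complex.d 1 0 ≫ (ModuleCat.ofHom (g 0) : P 0 ⟶ K 0) = 0 := by
  rw [complex_d]
  exact ModuleCat.hom_ext (LinearMap.ext fun x => h.apply_apply 0 _)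

/-- The augmentation of the complex of the `P i` to `K 0`. -/
def augmentation (h : SyzygySequence K P f g) :
    h.complex ⟶ (ChainComplex.single₀ (ModuleCat.{u} B)).obj (K 0) :=
  (ChainComplex.toSingle₀Equiv _ _).symm ⟨_, h.complex_d_comp⟩

theorem augmentation_f_zero (h : SyzygySequence K P f g) :
    h.augmentation.f 0 = (ModuleCat.ofHom (g 0) : P 0 ⟶ K 0) :=
  ChainComplex.toSingle₀Equiv_symm_apply_f_zero _ _

/-- The resolution of `K 0` by the modules `P i`. -/
def projectiveResolution (h : SyzygySequence K P f g) : ProjectiveResolution (K 0) where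
  complex := h.complex
  projective i := (IsProjective.iff_projective (P i)).1 (h.projective i)
  π := h.augmentation
  quasiIso := ⟨fun i => by
    cases i
    · rw [ChainComplex.quasiIsoAt₀_iff, ShortComplex.quasiIso_iff_of_zeros']
      · refine ⟨(ShortComplex.ShortExact.moduleCat_exact_iff_function_exact _).2 ?_,
          (ModuleCat.epi_iff_surjective _).2 ?_⟩
        · change Function.Exact (h.complex.d 1 0) (h.augmentation.f 0)
          rw [augmentation_f_zero, complex_d]
          intro x
          refine ((h.isShortExact 0).exact x).trans ⟨fun ⟨y, hy⟩ => ?_, fun ⟨y, hy⟩ => ⟨_, hy⟩⟩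
          obtain ⟨z, rfl⟩ := (h.isShortExact 1).surjective y
          exact ⟨z, hy⟩
        · change Function.Surjective (h.augmentation.f 0)
          rw [augmentation_f_zero]
          exact (h.isShortExact 0).surjective
      all_goals rfl
    · rw [quasiIsoAt_iff_exactAt']
      · exact h.complex_exactAt _
      · apply ChainComplex.exactAt_succ_single_obj⟩

theorem hasFGProjectiveResolution (h : SyzygySequence K P f g) :
    HasFGProjectiveResolution B (K 0) :=
  ⟨h.projectiveResolution, h.finite⟩

/-- Above the little restricted flat dimension of `T`, the resolution stays exact under
`T ⊗_B -`. -/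
theorem exact_tensor (h : SyzygySequence K P f g) {T : Type u} [AddCommGroup T] [Module Bᵐᵒᵖ T]
    {m : ℕ} (hT : LittleRestrictedFlatDimLE B T m) (hfd : ∃ n, FlatDimLE B n (K 0)) {i : ℕ}
    (hi : m ≤ i) :
    Function.Exact
      (BalancedTensor.map B (LinearMap.id : T →ₗ[Bᵐᵒᵖ] T) ((f (i + 1)).comp (g (i + 2))))
      (BalancedTensor.map B (LinearMap.id : T →ₗ[Bᵐᵒᵖ] T) ((f i).comp (g (i + 1)))) := by
  have hz := (hT (i + 1) (by lia) (K 0) hfd h.hasFGProjectiveResolution).of_iso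
    (h.projectiveResolution.isoLeftDerivedObj (tensorFunctor B T) (i + 1)).symm
  have hex : (((tensorFunctor B T).mapHomologicalComplex _).obj h.complex).ExactAt (i + 1) := by
    rw [HomologicalComplex.exactAt_iff_isZero_homology]
    exact hz
  rw [HomologicalComplex.exactAt_iff' _ (i + 1 + 1) (i + 1) i (by simp) (by simp),
    ShortComplex.ab_exact_iff_function_exact] at hex
  change Function.Exact ((tensorFunctor B T).map (h.complex.d (i + 1 + 1) (i + 1)))
    ((tensorFunctor B T).map (h.complex.d (i + 1) i)) at hex
  rw [complex_d, complex_d] at hex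
  exact hex

end SyzygySequence

end Resolution

/-! ### Comparison of finitistic dimensions -/

section Comparison

theorem BalancedTensor.subsingleton_of_right {B : Type u} [Ring B] (T Y : Type u) [AddCommGroup T]
    [Module Bᵐᵒᵖ T] [AddCommGroup Y] [Module B Y] [Subsingleton Y] :
    Subsingleton (BalancedTensor B T Y) := by
  have h : AddMonoidHom.id (BalancedTensor B T Y) = 0 := BalancedTensor.hom_ext B fun t y => by
    change BalancedTensor.tmul B t y = 0
    rw [Subsingleton.elim y 0, BalancedTensor.tmul, TensorProduct.tmul_zero, map_zero]
  exact subsingleton_of_forall_eq 0 fun z => DFunLike.congr_fun h z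

attribute [local instance] bimoduleHom

/-- If `0 → L → P → P'` is exact and the units of the tensor-hom adjunction at `P` and `P'` are
isomorphisms, then `L` is the module of homomorphisms from `M` to the kernel of
`M ⊗_B P → M ⊗_B P'`. -/
def BalancedTensor.linearEquivHom {A B M L P P' : Type u} [Ring A] [Ring B] [AddCommGroup M]
    [Module A M] [Module Bᵐᵒᵖ M] [SMulCommClass A Bᵐᵒᵖ M] [AddCommGroup L] [Module B L]
    [AddCommGroup P] [Module B P] [AddCommGroup P'] [Module B P'] {f : L →ₗ[B] P}
    {g : P →ₗ[B] P'} (hf : Function.Injective f) (hfg : Function.Exact f g)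
    (hP : Function.Bijective (BalancedTensor.unit A (B := B) M P))
    (hP' : Function.Injective (BalancedTensor.unit A (B := B) M P'))
    (Z : Submodule A (BalancedTensor B M P)) (hZ : Z = LinearMap.ker (BalancedTensor.lmap A M g)) :
    L ≃ₗ[B] (M →ₗ[A] Z) :=
  have hmem (x : L) (t : M) : BalancedTensor.unit A M P (f x) t ∈ Z := by
    have h0 : BalancedTensor.unit A (B := B) M P' (g (f x)) t = 0 := by
      rw [hfg.apply_apply_eq_zero, map_zero, LinearMap.zero_apply]
    rw [hZ]
    exact h0
  LinearEquiv.ofBijective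
    ({ toFun := fun x => (BalancedTensor.unit A M P (f x)).codRestrict Z (hmem x)
       map_add' := fun x x' => by
        have h0 := (BalancedTensor.unit A (B := B) M P).map_add (f x) (f x')
        rw [← map_add] at h0
        exact LinearMap.ext fun t => Subtype.ext (LinearMap.congr_fun h0 t)
       map_smul' := fun b x => by
        have h0 := (BalancedTensor.unit A (B := B) M P).map_smul b (f x)
        rw [← map_smul] at h0
        exact LinearMap.ext fun t => Subtype.ext (LinearMap.congr_fun h0 t) } :
      L →ₗ[B] (M →ₗ[A] Z)) (by
    constructor
    · intro x x' h
      refine hf (hP.1 (LinearMap.ext fun t => ?_))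
      exact congrArg Subtype.val (LinearMap.congr_fun h t)
    · intro h
      obtain ⟨y, hy⟩ := hP.2 (Z.subtype.comp h)
      have h0 : g y = 0 := by
        refine hP' (LinearMap.ext fun t => ?_)
        have h1 : BalancedTensor.unit A M P y t = (h t).1 := LinearMap.congr_fun hy t
        have h2 : BalancedTensor.lmap A M g (BalancedTensor.unit A M P y t) = 0 := by
          rw [h1, ← LinearMap.mem_ker, ← hZ]
          exact (h t).2
        rw [map_zero, LinearMap.zero_apply]
        exact h2
      obtain ⟨x, rfl⟩ := (hfg y).1 h0
      exact ⟨x, LinearMap.ext fun t => Subtype.ext (LinearMap.congr_fun hy t)⟩)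

/-- The bound `pd Y ≤ n + m + p` for a single module `Y`, over a ring `B` that acts as the full
endomorphism ring of `M`. -/
theorem hasProjectiveDimensionLE_of_isEndBimodule {A : Type u} [Ring A] [IsNoetherianRing A]
    {B : Type u} [Ring B] [IsNoetherianRing B] {E M : ModuleCat.{u} A} [Module Bᵐᵒᵖ M]
    [SMulCommClass A Bᵐᵒᵖ M] (hB : IsEndBimodule A B M)
    (hE : ∀ X : ModuleCat.{u} A, IsGorensteinProjective A X ↔ IsInAdd A E X)
    (hM : IsGorensteinProjective A M) {n m p : ℕ} (hn : 2 ≤ n) (hA : finDim A ≤ n)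
    (hm : LittleRestrictedFlatDimLE B M m)
    (hp : HasProjectiveDimensionLE (ModuleCat.of B (M →ₗ[A] E)) p)
    (Y : ModuleCat.{u} B) (hY : Module.Finite B Y) (hpd : ∃ N, HasProjectiveDimensionLE Y N) :
    HasProjectiveDimensionLE Y (n + m + p) := by
  obtain ⟨k, rfl⟩ : ∃ k, n = k + 2 := ⟨n - 2, by lia⟩
  obtain ⟨N, hN⟩ := hpd
  obtain ⟨K, P, f, g, rfl, hs, hsucc⟩ := exists_syzygySequence Y hY
  have hKN : Module.Projective B (K N) := by
    rw [HasProjectiveDimensionLE, show N + 1 = 0 + 1 + N by lia,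
      hs.hasProjectiveDimensionLT_iff, ← projective_iff_hasProjectiveDimensionLT_one] at hN
    exact (IsProjective.iff_projective (K N)).2 hN
  have hKzero (i : ℕ) : Subsingleton (K (N + 1 + i)) := by
    induction i with
    | zero => exact hsucc N hKN
    | succ i ih => exact hsucc (N + 1 + i) (Module.Projective.of_free (P := K (N + 1 + i)))
  have hPzero (i : ℕ) (hi : N + 1 ≤ i) : Subsingleton (P i) := by
    obtain ⟨i, rfl⟩ := Nat.exists_eq_add_of_le hi
    have h1 := hKzero i
    have h2 := hKzero (i + 1)
    refine subsingleton_of_forall_eq 0 fun x => ?_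
    obtain ⟨y, rfl⟩ := ((hs.isShortExact (N + 1 + i)).exact x).1 (Subsingleton.elim _ _)
    rw [Subsingleton.elim y (0 : K (N + 1 + (i + 1))), map_zero]
  -- The complex `M ⊗_B P` from degree `m` on is an exact complex of Gorenstein projectives.
  let G : ℕ → ModuleCat.{u} A := fun i => ModuleCat.of A (BalancedTensor B M (P (m + i)))
  let d (i : ℕ) : G (i + 1) →ₗ[A] G i := BalancedTensor.lmap A M ((f (m + i)).comp (g (m + i + 1)))
  have hd (i : ℕ) : Function.Exact (d (i + 1)) (d i) :=
    hs.exact_tensor hm ⟨N, hs.flatDimLE N 0 (by rwa [Nat.zero_add])⟩ (Nat.le_add_right m i)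
  have hG (i : ℕ) : IsGorensteinProjective A (G i) :=
    (hE _).2 (BalancedTensor.isInAdd ((hE M).1 hM) (hs.finite _) (hs.projective _))
  let Z := ModuleCat.of A (LinearMap.range (d (k + 1)))
  have hZ : IsInAdd A E Z := (hE Z).1 <| isGorensteinProjective_range
    (fun X X' s r h hX' => (hE X).2 (.of_retract h ((hE X').1 hX'))) hA G d hG hd (N := N + 1)
    (fun i hi => by
      have := hPzero (m + i) (by lia)
      exact BalancedTensor.subsingleton_of_right M (P (m + i))) le_rfl
  -- By left exactness of `Hom_A(M, -)`, the syzygy `K (m + k + 2)` of `Y` is `Hom_A(M, Z)`.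
  let q := m + k
  have hunit (i : ℕ) := BalancedTensor.unit_bijective hB (hs.finite i) (hs.projective i)
  have hex : Function.Exact (f (q + 1)) ((f q).comp (g (q + 1))) := fun y =>
    ⟨fun hy => ((hs.isShortExact (q + 1)).exact y).1
      ((hs.isShortExact q).injective (hy.trans (map_zero _).symm)), by
      rintro ⟨x, rfl⟩
      rw [LinearMap.comp_apply, hs.apply_apply, map_zero]⟩
  let e : K (q + 2) ≃ₗ[B] (M →ₗ[A] Z) := BalancedTensor.linearEquivHom
    (hs.isShortExact (q + 1)).injective hex (hunit (q + 1)) (hunit q).1 _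
    (LinearMap.exact_iff.1 (hd k)).symm
  have hpd : HasProjectiveDimensionLT (ModuleCat.of B (M →ₗ[A] Z)) (p + 1) :=
    hasProjectiveDimensionLT_hom hZ hp
  have hK : HasProjectiveDimensionLT (K (q + 2)) (p + 1) := hasProjectiveDimensionLT_of_iso
    (LinearEquiv.toModuleIso (X₁ := ModuleCat.of B (M →ₗ[A] Z)) (X₂ := K (q + 2))
      e.symm) (p + 1)
  rw [← hs.hasProjectiveDimensionLT_iff] at hK
  rwa [HasProjectiveDimensionLE, show k + 2 + m + p + 1 = p + 1 + (q + 2) by lia]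

/-- The infimum defining the little restricted flat dimension is attained when it is finite. -/
theorem LittleRestrictedFlatDimLE.of_littleRestrictedFlatDim_le {B T : Type u} [Ring B]
    [AddCommGroup T] [Module Bᵐᵒᵖ T] {m : ℕ} (h : littleRestrictedFlatDim B T ≤ m) :
    LittleRestrictedFlatDimLE B T m := by
  have hlt : littleRestrictedFlatDim B T < (m + 1 : ℕ) :=
    h.trans_lt (by exact_mod_cast Nat.lt_succ_self m)
  simp only [littleRestrictedFlatDim, iInf_lt_iff] at hlt
  obtain ⟨m', h', hm'⟩ := hlt
  have : m' < m + 1 := by exact_mod_cast hm'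
  exact fun i hi => h' i (by lia)

theorem finDim_eq_bot (B : Type u) [Ring B] [Subsingleton B] : finDim B = ⊥ := by
  refine le_bot_iff.1 (iSup_le fun Y => iSup_le fun _ => iSup_le fun _ => ?_)
  have : Subsingleton Y := Module.subsingleton B Y
  exact ((projectiveDimension_eq_bot_iff Y).2 (ModuleCat.isZero_of_subsingleton Y)).le

end Comparison

end

theorem theorem3p1 {R : Type*} [CommRing R] [IsArtinianRing R]
    {A : Type u} [Ring A] [Algebra R A] [Module.Finite R A]
    (hCM : IsCMFinite A) (E : ModuleCat.{u} A)
    (hE : ∀ X : ModuleCat.{u} A, IsGorensteinProjective A X ↔ IsInAdd A E X)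
    (hA : 2 ≤ finDim A)
    (M : ModuleCat.{u} A) (hM : IsGorensteinProjective A M) :
    finDim (EndAlg A M) ≤
      finDim A + (littleRestrictedFlatDim (EndAlg A M) M : WithBot ℕ∞) +
        projectiveDimension (ModuleCat.of (EndAlg A M) (M →ₗ[A] E)) := by
  have : IsNoetherianRing A := isNoetherian_of_tower R inferInstance
  have := hM.finite
  have := EndAlg.isNoetherianRing A M R
  -- For `M = 0` the ring `End_A M` is trivial, and both sides are `⊥`.
  rcases subsingleton_or_nontrivial M with hM0 | hM0
  · have : Subsingleton (EndAlg A M) :=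
      DomMulAct.mk.symm.injective.subsingleton (β := Module.End A M)
    rw [finDim_eq_bot]
    exact bot_le
  -- A nonzero `M` is a direct summand of a power of `E`, so `Hom_A(M, E)` is nonzero.
  have hpd : projectiveDimension (ModuleCat.of (EndAlg A M) (M →ₗ[A] E)) ≠ ⊥ := by
    rw [Ne, projectiveDimension_eq_bot_iff]
    intro h0
    have := ModuleCat.subsingleton_of_isZero h0
    have : Subsingleton (M →ₗ[A] E) := this
    obtain ⟨n, s, r, hrs⟩ := (hE M).1 hM
    obtain ⟨x, hx⟩ := exists_ne (0 : M)
    have hs : s x = 0 := funext fun i =>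
      LinearMap.congr_fun (Subsingleton.elim ((LinearMap.proj i).comp s) 0) x
    refine hx ?_
    have h1 : r (s x) = x := LinearMap.congr_fun hrs x
    rw [← h1, hs, map_zero]
  have hA0 : finDim A ≠ ⊥ := fun h => by
    rw [h] at hA
    exact absurd (le_bot_iff.1 hA) (by decide)
  obtain ⟨a, ha⟩ := WithBot.ne_bot_iff_exists.1 hA0
  obtain ⟨c, hc⟩ := WithBot.ne_bot_iff_exists.1 hpd
  rw [← ha, ← hc]
  rw [← ha] at hA
  generalize hr : littleRestrictedFlatDim (EndAlg A M) M = r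
  induction a with
  | top => rw [← WithBot.coe_add, ← WithBot.coe_add, top_add, top_add]; exact le_top
  | coe n =>
  induction r with
  | top => rw [← WithBot.coe_add, ← WithBot.coe_add, add_top, top_add]; exact le_top
  | coe m =>
  induction c with
  | top => rw [← WithBot.coe_add, ← WithBot.coe_add, add_top]; exact le_top
  | coe p =>
  have hn' : (2 : ℕ∞) ≤ n := WithBot.coe_le_coe.1 hA
  have hn : 2 ≤ n := by exact_mod_cast hn'
  refine iSup_le fun Y => iSup_le fun hY => iSup_le fun hlt => ?_
  have hp := (projectiveDimension_le_iff _ p).1 hc.ge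
  have := hasProjectiveDimensionLE_of_isEndBimodule (EndAlg.isEndBimodule A M) hE hM hn ha.ge
    (.of_littleRestrictedFlatDim_le hr.le) hp Y hY ((projectiveDimension_ne_top_iff Y).1 hlt.ne)
  exact_mod_cast (projectiveDimension_le_iff Y (n + m + p)).2 this
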